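/- Let $X$ and $Y$ be complex Banach spaces, and suppose that the dual $X'$ is separable and has the approximation property. Let $\mathcal{A}_u(X;Y')$ be the space of all functions $f$ from the closed unit ball $B_X$ of $X$ to $Y'$ that are holomorphic on the open unit ball and uniformly continuous on $B_X$, with the supremum norm. If $f=\sum_{n\ge 0}P_n$ is the Taylor series of $f$ at $0$, where $P_n(x)=\Phi_n(x,\dots,x)$ with $\Phi_n$ continuous, $n$-linear and symmetric, the Aron–Berner extension of $f$ is the function $\overline f\in\mathcal{A}_u(X'';Y''')$ given on the open unit ball of $X''$ by $\overline f(x'')=\sum_{n\ge 0}\overline{\Phi_n}(x'',\dots,x'')$, and extended by continuity to the closed unit ball $B_{X''}$; here $$\overline{\Phi_n}(x_1'',\dots,x_n'')=w^*\text{-}\lim_{\alpha_1}\dots\lim_{\alpha_n}\Phi_n(x_{1,\alpha_1},\dots,x_{n,\alpha_n})$$ for nets $(x_{i,\alpha_i})_{\alpha_i}$ in $X$ that converge weak-star to $x_i''\in X''$. One says that $\overline f$ attains its norm if $\|\overline f(x_0'')\|=\sup_{x''\in B_{X''}}\|\overline f(x'')\|$ for some $x_0''\in B_{X''}$. Then the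 set of all functions in $\mathcal{A}_u(X;Y')$ whose Aron–Berner extensions attain their norms is dense in $\mathcal{A}_u(X;Y')$. Moreover, given $g\in\mathcal{A}_u(X;Y')$ and $\varepsilon>0$, there exists a continuous polynomial $P\colon X\to Y'$ whose Aron–Berner extension attains its norm and such that $\|g-P\|=\sup_{x\in B_X}\|g(x)-P(x)\|<\varepsilon$. -/

import Mathlib

open Metric BoundedContinuousFunction

noncomputable section

/-- A normed space `E` has the approximation property if the identity of `E` can be approximated,
uniformly on each compact set, by bounded operators of finite rank. -/
def HasApproximationProperty (E : Type*) [NormedAddCommGroup E] [NormedSpace ℂ E] : Prop :=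
  ∀ K : Set E, IsCompact K → ∀ ε : ℝ, 0 < ε →
    ∃ T : E →L[ℂ] E, FiniteDimensional ℂ T.range ∧ ∀ x ∈ K, ‖T x - x‖ < ε

/-- The bidual `X''`. -/
abbrev Bidual (X : Type*) [NormedAddCommGroup X] [NormedSpace ℂ X] : Type _ :=
  StrongDual ℂ (StrongDual ℂ X)

/-- Extension by zero, to the whole space, of a function on the closed unit ball. -/
def ballExtend {X W : Type*} [NormedAddCommGroup X] [Zero W] (f : closedBall (0 : X) 1 → W)
    (x : X) : W :=
  open Classical in if h : x ∈ closedBall (0 : X) 1 then f ⟨x, h⟩ else 0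

/-- The space `A_u(X; W)` of functions that are uniformly continuous on the closed unit ball of `X`
and holomorphic (locally given by a convergent power series) on the open unit ball, with the
supremum norm inherited from the space of bounded continuous functions.
(A uniformly continuous function on the closed unit ball is automatically bounded.) -/
def Au (X W : Type*) [NormedAddCommGroup X] [NormedSpace ℂ X]
    [NormedAddCommGroup W] [NormedSpace ℂ W] : Submodule ℂ (closedBall (0 : X) 1 →ᵇ W) where
  carrier := {f | UniformContinuous f ∧ AnalyticOnNhd ℂ (ballExtend f) (ball 0 1)}
  add_mem' := by
    rintro f g ⟨hf, hf'⟩ ⟨hg, hg'⟩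
    refine ⟨hf.add hg, (hf'.add hg').congr isOpen_ball fun x hx => ?_⟩
    simp [ballExtend, ball_subset_closedBall hx]
  zero_mem' := by
    refine ⟨uniformContinuous_const, ?_⟩
    exact (analyticOnNhd_const (v := (0 : W))).congr isOpen_ball fun x hx => by simp [ballExtend]
  smul_mem' := by
    rintro c f ⟨hf, hf'⟩
    refine ⟨hf.const_smul c, (hf'.const_smul (c := c)).congr isOpen_ball fun x hx => ?_⟩
    simp [ballExtend, ball_subset_closedBall hx]

section Extension

variable {X W : Type*} [NormedAddCommGroup X] [NormedSpace ℂ X]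
  [NormedAddCommGroup W] [NormedSpace ℂ W]

/-- Evaluation at `v = (x₁'', …, xₙ'')` of the Arens extension of scalar `n`-linear forms,
as a functional of the form `φ`. For `n + 1` it is `x₁''` applied to the functional
`x₁ ↦ (extension of φ(x₁, ·, …, ·) at (x₂'', …, xₙ₊₁''))`; that is, the iterated limit
`lim_{α₁} … lim_{αₙ₊₁} φ(x_{1,α₁}, …, x_{n+1,αₙ₊₁})` along nets of `X` that converge weak-star
to the `xᵢ''`. -/
def arensEval : (n : ℕ) → (Fin n → Bidual X) →
    StrongDual ℂ (ContinuousMultilinearMap ℂ (fun _ : Fin n => X) ℂ)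
  | 0, _ => ContinuousMultilinearMap.apply ℂ (fun _ : Fin 0 => X) ℂ 0
  | n + 1, v =>
      (v 0 ∘L ContinuousLinearMap.compL ℂ X _ ℂ (arensEval n (Fin.tail v))) ∘L
        ((continuousMultilinearCurryLeftEquiv ℂ (fun _ : Fin (n + 1) => X)
          ℂ).toContinuousLinearEquiv :
            ContinuousMultilinearMap ℂ (fun _ : Fin (n + 1) => X) ℂ →L[ℂ]
              X →L[ℂ] ContinuousMultilinearMap ℂ (fun _ : Fin n => X) ℂ)

/-- The Arens extension `X'' × ⋯ × X'' → W''` of an `n`-linear map `Φ : X × ⋯ × X → W`. The iterated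
limit is weak-star in `W''`, so it is computed after pairing with each functional `w' ∈ W'`:
its value at `v` is `w' ↦ (extension of w' ∘ Φ at v)`. -/
def arensExtension {n : ℕ} (Φ : ContinuousMultilinearMap ℂ (fun _ : Fin n => X) W)
    (v : Fin n → Bidual X) : Bidual W :=
  arensEval n v ∘L
    (ContinuousLinearMap.compContinuousMultilinearMapL ℂ (fun _ : Fin n => X) W ℂ).flip Φ

/-- The continuous symmetric `n`-linear map `Φₙ = Dⁿf(0) / n!` such that `x ↦ Φₙ(x, …, x)` is the
`n`-th homogeneous polynomial of the Taylor series of `f` at `0`. -/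
def taylorMultilinear (f : Au X W) (n : ℕ) :
    ContinuousMultilinearMap ℂ (fun _ : Fin n => X) W :=
  ((n.factorial : ℂ)⁻¹) • iteratedFDeriv ℂ n (ballExtend (f : closedBall (0 : X) 1 →ᵇ W)) 0

/-- `F` is the Aron–Berner extension of `f`: the function in `A_u(X''; W'')` which on the open unit
ball of `X''` is the sum of the Aron–Berner extensions of the homogeneous Taylor polynomials of `f`
at `0` (so that on the closed ball it is the continuous extension of that sum). -/
def IsAronBernerExtension (f : Au X W) (F : Au (Bidual X) (Bidual W)) : Prop :=
  ∀ z : closedBall (0 : Bidual X) 1, ‖(z : Bidual X)‖ < 1 →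
    HasSum (fun n : ℕ => arensExtension (taylorMultilinear f n) fun _ => (z : Bidual X))
      ((F : closedBall (0 : Bidual X) 1 →ᵇ Bidual W) z)

/-- `f` attains its supremum norm at a point of the closed unit ball. -/
def AttainsNorm (f : Au X W) : Prop :=
  ∃ x : closedBall (0 : X) 1, ‖(f : closedBall (0 : X) 1 →ᵇ W) x‖ = ‖f‖

/-- The Aron–Berner extension of `f` exists and attains its norm. -/
def AronBernerAttainsNorm (f : Au X W) : Prop :=
  ∃ F : Au (Bidual X) (Bidual W), IsAronBernerExtension f F ∧ AttainsNorm F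

/-- `f` is (the restriction to the closed unit ball of) a continuous polynomial: a finite sum of
continuous homogeneous polynomials `x ↦ Φⱼ(x, …, x)`. -/
def IsPolynomial (f : Au X W) : Prop :=
  ∃ (k : ℕ) (Φ : ∀ j : ℕ, ContinuousMultilinearMap ℂ (fun _ : Fin j => X) W),
    ∀ x : closedBall (0 : X) 1,
      (f : closedBall (0 : X) 1 →ᵇ W) x = ∑ j ∈ Finset.range (k + 1), Φ j fun _ => (x : X)

end Extension

end

/-!
The proof perturbs a polynomial so that its almost maximizers behave well, and then passes to the
bidual by averaging. The separability of `X'` makes countably many conditions sufficient for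
weak-star convergence. The values may lie in any Banach space `W`.

**Generic polynomials.** The polynomials of degree at most `n` are the functions
`p x = Ψ ((x, 1), …, (x, 1))` with `Ψ` in the Banach space of `n`-linear maps on `X × ℂ`. If `r` is
a scalar polynomial for which all `x ↦ r x • y` have degree at most `n`, then adding a small
multiple of `r • y`, aligned with `p x₀` at an almost maximizer `x₀`, forces `|r|` to be
essentially at least `|r x₀|` at all almost maximizers of the new polynomial
(`exists_perturbation`). By Baire's theorem this can be exploited for countably many conditions
simultaneously (`exists_generic`). Generically, with `F` the filter generated by the sets of almost
maximizers of `‖p‖` on the unit ball: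

* the moduli of `1 + c ψ`, for `ψ` in a dense sequence of `X'` and `c ∈ {±1, ±i}`, converge along
  `F`, so that `F` converges weak-star to some `z` in the unit ball of `X''`;
* for each `ε > 0` there is a functional `w` in the unit ball of `W'` with `|w (p x)|` within `ε`
  of the supremum `m` of `‖p‖` eventually along `F`;
* in `|w (p (a + s x))|`, a part of the vector `s x` can be moved to the centre `a` and the rest
  replaced by any other almost maximizer, with an arbitrarily small loss, for frequently many `x`.

**Averages.** The Arens extension of a symmetric form is in general not symmetric, but it is so on
the span of `X` and a single `z ∈ X''`. There the Aron–Berner extension `p̄` has a first-order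
expansion, and the derivative in the direction `x - z` tends to `0` as `x → z` weak-star. Hence
replacing `z / M` by `x / M` costs `O(1 / M²)`, and `M` replacements lead from `z` to an average
`a = (x₁ + ⋯ + x_M) / M` in the unit ball of `X` with `p a - p̄ z = O(1 / M)` after application of a
functional (`exists_average_near_arensSum`). With a filter from Goldstine's theorem this yields the
theorem of Davie and Gamelin, `‖p̄‖ ≤ m` on the unit ball of `X''`. With the filter `F` of a generic
`p`, the `xᵢ` can be chosen so that `|w (p a)|` stays close to `m`, because of the third property
above; thus `‖p̄ z‖ ≥ m`, and `p̄` attains its norm at `z`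
(`exists_aronBernerAttainsNorm_near`).

**Approximation.** Polynomials are dense in `Au X W`, by dilation and the Cauchy estimates
(`exists_formSum_near`).
-/

noncomputable section

-- needed for the normed structures on iterated duals
set_option maxSynthPendingDepth 3

open Filter Topology

/-! ### The Arens extension of multilinear forms -/

section Arens

variable {X W : Type*} [NormedAddCommGroup X] [NormedSpace ℂ X]
  [NormedAddCommGroup W] [NormedSpace ℂ W]

theorem arensEval_succ_apply (n : ℕ) (v : Fin (n + 1) → Bidual X)
    (φ : ContinuousMultilinearMap ℂ (fun _ : Fin (n + 1) => X) ℂ) :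
    arensEval (n + 1) v φ = v 0 (arensEval n (Fin.tail v) ∘L φ.curryLeft) := rfl

theorem arensEval_cons_apply (n : ℕ) (b : Bidual X) (v : Fin n → Bidual X)
    (φ : ContinuousMultilinearMap ℂ (fun _ : Fin (n + 1) => X) ℂ) :
    arensEval (n + 1) (Fin.cons b v) φ = b (arensEval n v ∘L φ.curryLeft) := rfl

theorem arensEval_const_succ (n : ℕ) (b : Bidual X)
    (φ : ContinuousMultilinearMap ℂ (fun _ : Fin (n + 1) => X) ℂ) :
    arensEval (n + 1) (fun _ => b) φ = b (arensEval n (fun _ => b) ∘L φ.curryLeft) := rfl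

theorem arensEval_inclusion (n : ℕ) (x : Fin n → X)
    (φ : ContinuousMultilinearMap ℂ (fun _ : Fin n => X) ℂ) :
    arensEval n (fun i => NormedSpace.inclusionInDoubleDual ℂ X (x i)) φ = φ x := by
  induction n with
  | zero =>
    simp only [arensEval, ContinuousMultilinearMap.apply_apply]
    congr 1
    exact Subsingleton.elim _ _
  | succ n ih =>
    rw [arensEval_succ_apply]
    have : (Fin.tail fun i => NormedSpace.inclusionInDoubleDual ℂ X (x i))
      = fun i => NormedSpace.inclusionInDoubleDual ℂ X (Fin.tail x i) := rfl
    rw [this, NormedSpace.dual_def]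
    simp [ih]

/-- A form of several variables is symmetric if it is invariant under permutations of them. -/
def IsSymmForm {n : ℕ} {V : Type*} [NormedAddCommGroup V] [NormedSpace ℂ V]
    (φ : ContinuousMultilinearMap ℂ (fun _ : Fin n => X) V) : Prop :=
  ∀ (σ : Equiv.Perm (Fin n)) (v : Fin n → X), φ (fun i => v (σ i)) = φ v

theorem IsSymmForm.curryLeft {n : ℕ}
    {φ : ContinuousMultilinearMap ℂ (fun _ : Fin (n + 1) => X) W} (h : IsSymmForm φ) (x : X) :
    IsSymmForm (φ.curryLeft x) := by
  intro σ v
  rw [ContinuousMultilinearMap.curryLeft_apply, ContinuousMultilinearMap.curryLeft_apply,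
    ← h (Equiv.Perm.decomposeFin.symm (0, σ)) (Fin.cons x v)]
  congr 1
  ext i
  refine Fin.cases ?_ (fun j => ?_) i
  · simp
  · simp [Equiv.Perm.decomposeFin_symm_apply_succ, Fin.cons_succ]

theorem IsSymmForm.swap_head {n : ℕ}
    {φ : ContinuousMultilinearMap ℂ (fun _ : Fin (n + 2) => X) W} (h : IsSymmForm φ) (x y : X) :
    (φ.curryLeft x).curryLeft y = (φ.curryLeft y).curryLeft x := by
  ext v
  simp only [ContinuousMultilinearMap.curryLeft_apply]
  rw [← h (Equiv.swap 0 1) (Fin.cons y (Fin.cons x v))]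
  congr 1
  ext i
  refine Fin.cases ?_ (fun j => Fin.cases ?_ (fun k => ?_) j) i
  · simp [Equiv.swap_apply_left]
  · have : (Fin.succ 0 : Fin (n + 2)) = 1 := rfl
    simp only [this, Equiv.swap_apply_right]
    rfl
  · rw [Equiv.swap_apply_of_ne_of_ne]
    · rfl
    · exact Fin.succ_ne_zero _
    · exact fun e => Fin.succ_ne_zero k (Fin.succ_injective _ e)

theorem arensEval_update_add {n : ℕ} (v : Fin n → Bidual X) (i : Fin n)
    (b c : Bidual X) : arensEval n (Function.update v i (b + c)) =
      arensEval n (Function.update v i b) + arensEval n (Function.update v i c) := by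
  induction n with
  | zero => exact i.elim0
  | succ n ih =>
    ext φ
    rw [_root_.add_apply]
    refine Fin.cases ?_ (fun j => ?_) i
    · simp only [arensEval_succ_apply, Fin.tail_update_zero, Function.update_self, _root_.add_apply]
    · simp only [arensEval_succ_apply, Fin.tail_update_succ, ih, ContinuousLinearMap.add_comp,
        map_add, ne_eq, (Fin.succ_ne_zero j).symm, not_false_eq_true, Function.update_of_ne]

theorem arensEval_update_smul {n : ℕ} (v : Fin n → Bidual X) (i : Fin n)
    (c : ℂ) (b : Bidual X) : arensEval n (Function.update v i (c • b)) =
      c • arensEval n (Function.update v i b) := by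
  induction n with
  | zero => exact i.elim0
  | succ n ih =>
    ext φ
    rw [_root_.smul_apply]
    refine Fin.cases ?_ (fun j => ?_) i
    · simp only [arensEval_succ_apply, Fin.tail_update_zero, Function.update_self, _root_.smul_apply]
    · simp only [arensEval_succ_apply, Fin.tail_update_succ, ih, ContinuousLinearMap.smul_comp,
        map_smul, ne_eq, (Fin.succ_ne_zero j).symm, not_false_eq_true, Function.update_of_ne]

theorem norm_arensEval_le {n : ℕ} (v : Fin n → Bidual X) : ‖arensEval n v‖ ≤ ∏ i, ‖v i‖ := by
  induction n with
  | zero =>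
    refine ContinuousLinearMap.opNorm_le_bound _ (by simp) fun φ => ?_
    have := φ.le_opNorm 0
    show ‖φ 0‖ ≤ _
    simpa only [Finset.univ_eq_empty, Finset.prod_empty, mul_one, one_mul] using this
  | succ n ih =>
    refine ContinuousLinearMap.opNorm_le_bound _ (by positivity) fun φ => ?_
    rw [arensEval_succ_apply, Fin.prod_univ_succ]
    calc ‖v 0 (arensEval n (Fin.tail v) ∘L φ.curryLeft)‖
        ≤ ‖v 0‖ * ‖arensEval n (Fin.tail v) ∘L φ.curryLeft‖ := (v 0).le_opNorm _
      _ ≤ ‖v 0‖ * (‖arensEval n (Fin.tail v)‖ * ‖φ.curryLeft‖) := by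
        gcongr; exact ContinuousLinearMap.opNorm_comp_le _ _
      _ ≤ ‖v 0‖ * ((∏ i : Fin n, ‖v i.succ‖) * ‖φ.curryLeft‖) := by
        gcongr; exact ih _
      _ = _ := by rw [ContinuousMultilinearMap.curryLeft_norm]; ring

theorem arensExtension_apply {n : ℕ} (Φ : ContinuousMultilinearMap ℂ (fun _ : Fin n => X) W)
    (v : Fin n → Bidual X) (w : StrongDual ℂ W) :
    arensExtension Φ v w = arensEval n v (w.compContinuousMultilinearMap Φ) := rfl

/-- The Arens extension of `Φ` as a continuous multilinear map on the bidual. -/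
def arensMultilinear {n : ℕ} (Φ : ContinuousMultilinearMap ℂ (fun _ : Fin n => X) W) :
    ContinuousMultilinearMap ℂ (fun _ : Fin n => Bidual X) (Bidual W) :=
  MultilinearMap.mkContinuous (𝕜 := ℂ)
    { toFun := arensExtension Φ
      map_update_add' := by
        intro inst v i b c
        obtain rfl : inst = instDecidableEqFin n := Subsingleton.elim _ _
        ext w
        simp [arensExtension_apply, arensEval_update_add]
      map_update_smul' := by
        intro inst v i b c
        obtain rfl : inst = instDecidableEqFin n := Subsingleton.elim _ _
        ext w
        simp [arensExtension_apply, arensEval_update_smul] } ‖Φ‖ (by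
    intro v
    refine ContinuousLinearMap.opNorm_le_bound _ (by positivity) fun w => ?_
    show ‖arensEval n v (w.compContinuousMultilinearMap Φ)‖ ≤ _
    calc _ ≤ ‖arensEval n v‖ * ‖w.compContinuousMultilinearMap Φ‖ :=
          ContinuousLinearMap.le_opNorm _ _
      _ ≤ (∏ i, ‖v i‖) * (‖w‖ * ‖Φ‖) := by
        gcongr
        · exact norm_arensEval_le v
        · exact ContinuousLinearMap.norm_compContinuousMultilinearMap_le _ _
      _ = _ := by ring)

theorem norm_arensEval_const_le {n : ℕ} {b : Bidual X} {R : ℝ} (hb : ‖b‖ ≤ R) :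
    ‖arensEval n fun _ => b‖ ≤ R ^ n := by
  refine (norm_arensEval_le _).trans ?_
  simp only [Finset.prod_const, Finset.card_univ, Fintype.card_fin]
  exact pow_le_pow_left₀ (norm_nonneg b) hb n

/-- On bounded sets `b ↦ arensEval n (b, …, b)` is Lipschitz. -/
theorem exists_arensEval_const_sub_le (n : ℕ) (R : ℝ) : ∃ C : ℝ, 0 ≤ C ∧
    ∀ u v : Bidual X, ‖u‖ ≤ R → ‖v‖ ≤ R →
      ‖arensEval n (fun _ => u) - arensEval n fun _ => v‖ ≤ C * ‖u - v‖ := by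
  induction n with
  | zero =>
    refine ⟨0, le_rfl, fun u v _ _ => ?_⟩
    have : (fun _ : Fin 0 => u) = fun _ => v := Subsingleton.elim _ _
    refine ContinuousLinearMap.opNorm_le_bound _ (by simp) fun φ => ?_
    rw [_root_.sub_apply, this, sub_self]
    simp
  | succ n ih =>
    obtain ⟨C, hC, h⟩ := ih
    refine ⟨|R| ^ n + |R| * C, by positivity, fun u v hu hv => ?_⟩
    have hR : 0 ≤ R := (norm_nonneg u).trans hu
    rw [abs_of_nonneg hR]
    refine ContinuousLinearMap.opNorm_le_bound _ (by positivity) fun φ => ?_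
    have e : (arensEval (n + 1) (fun _ => u) - arensEval (n + 1) fun _ => v) φ
        = (u - v) (arensEval n (fun _ => u) ∘L φ.curryLeft)
          + v ((arensEval n (fun _ => u) - arensEval n fun _ => v) ∘L φ.curryLeft) := by
      simp only [_root_.sub_apply, arensEval_const_succ, ContinuousLinearMap.sub_comp, map_sub]
      ring
    rw [e]
    calc _ ≤ ‖u - v‖ * (R ^ n * ‖φ‖) + R * ((C * ‖u - v‖) * ‖φ‖) := by
          refine norm_add_le_of_le ?_ ?_
          · refine (ContinuousLinearMap.le_opNorm _ _).trans ?_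
            gcongr
            refine (ContinuousLinearMap.opNorm_comp_le _ _).trans ?_
            rw [ContinuousMultilinearMap.curryLeft_norm]
            gcongr
            exact norm_arensEval_const_le hu
          · refine (ContinuousLinearMap.le_opNorm _ _).trans ?_
            gcongr
            refine (ContinuousLinearMap.opNorm_comp_le _ _).trans ?_
            rw [ContinuousMultilinearMap.curryLeft_norm]
            gcongr
            exact h u v hu hv
      _ = _ := by ring

/-- The elements `J a + t z` of the span of `X` and one element `z` of the bidual. -/
def spanPoint (z : Bidual X) (p : X × ℂ) : Bidual X :=
  NormedSpace.inclusionInDoubleDual ℂ X p.1 + p.2 • z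

/-- Arens extensions of symmetric forms need not be symmetric, but on the span of `X` and a
single `z` the first two arguments can be interchanged: the two limits commute as soon as one
of them is along a constant net. -/
theorem arensEval_swap_head {n : ℕ}
    {φ : ContinuousMultilinearMap ℂ (fun _ : Fin (n + 2) => X) ℂ} (h : IsSymmForm φ)
    (z : Bidual X) (p q : X × ℂ) (v : Fin n → Bidual X) :
    arensEval (n + 2) (Fin.cons (spanPoint z p) (Fin.cons (spanPoint z q) v)) φ =
      arensEval (n + 2) (Fin.cons (spanPoint z q) (Fin.cons (spanPoint z p) v)) φ := by
  have key : ∀ (a : X) (b : Bidual X),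
      arensEval (n + 2) (Fin.cons (NormedSpace.inclusionInDoubleDual ℂ X a) (Fin.cons b v)) φ =
      arensEval (n + 2) (Fin.cons b (Fin.cons (NormedSpace.inclusionInDoubleDual ℂ X a) v)) φ := by
    intro a b
    rw [arensEval_cons_apply, arensEval_cons_apply, NormedSpace.dual_def,
      ContinuousLinearMap.comp_apply, arensEval_cons_apply]
    congr 1
    ext x
    rw [ContinuousLinearMap.comp_apply, ContinuousLinearMap.comp_apply, arensEval_cons_apply,
      NormedSpace.dual_def, ContinuousLinearMap.comp_apply, h.swap_head]
  have add1 : ∀ a b c : Bidual X, arensEval (n + 2) (Fin.cons (a + b) (Fin.cons c v)) φ =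
      arensEval (n + 2) (Fin.cons a (Fin.cons c v)) φ +
      arensEval (n + 2) (Fin.cons b (Fin.cons c v)) φ := by
    intro a b c
    simp only [arensEval_cons_apply, _root_.add_apply]
  have smul1 : ∀ (t : ℂ) (b c : Bidual X), arensEval (n + 2) (Fin.cons (t • b) (Fin.cons c v)) φ =
      t * arensEval (n + 2) (Fin.cons b (Fin.cons c v)) φ := by
    intro a b c
    simp only [arensEval_cons_apply, _root_.smul_apply, smul_eq_mul]
  have hz : ∀ t s : ℂ, arensEval (n + 2) (Fin.cons (t • z) (Fin.cons (s • z) v)) φ =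
      arensEval (n + 2) (Fin.cons (s • z) (Fin.cons (t • z) v)) φ := by
    intro t s
    have aux : ∀ t s : ℂ, arensEval (n + 2) (Fin.cons (t • z) (Fin.cons (s • z) v)) φ =
        t * (s * arensEval (n + 2) (Fin.cons z (Fin.cons z v)) φ) := by
      intro t s
      rw [smul1]
      have e := congrArg (fun T => T φ)
        (arensEval_update_smul (Fin.cons z (Fin.cons z v) : Fin (n + 2) → Bidual X) 1 s z)
      have e2 : ∀ b : Bidual X, Function.update (Fin.cons z (Fin.cons z v) : Fin (n + 2) → Bidual X)
          1 b = Fin.cons z (Fin.cons b v) := by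
        intro b
        rw [show (1 : Fin (n + 2)) = Fin.succ 0 from rfl, ← Fin.cons_update, Fin.update_cons_zero]
      simp only [e2, _root_.smul_apply, smul_eq_mul] at e
      rw [e]
    rw [aux, aux]
    ring
  have add2 : ∀ a b c : Bidual X, arensEval (n + 2) (Fin.cons a (Fin.cons (b + c) v)) φ =
      arensEval (n + 2) (Fin.cons a (Fin.cons b v)) φ +
      arensEval (n + 2) (Fin.cons a (Fin.cons c v)) φ := by
    intro a b c
    have e := congrArg (fun T => T φ)
      (arensEval_update_add (Fin.cons a (Fin.cons b v) : Fin (n + 2) → Bidual X) 1 b c)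
    have e2 : ∀ c : Bidual X, Function.update (Fin.cons a (Fin.cons b v) : Fin (n + 2) → Bidual X)
        1 c = Fin.cons a (Fin.cons c v) := by
      intro b
      rw [show (1 : Fin (n + 2)) = Fin.succ 0 from rfl, ← Fin.cons_update, Fin.update_cons_zero]
    simpa only [e2, _root_.add_apply] using e
  simp only [spanPoint, add1, add2]
  rw [key p.1 (NormedSpace.inclusionInDoubleDual ℂ X q.1), key p.1 (q.2 • z), ← key q.1 (p.2 • z),
    hz p.2 q.2]
  ring

/-- The form of `arensEval_swap_head` in which the outer argument is written as a functional. -/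
theorem arensEval_move_head {n : ℕ}
    {φ : ContinuousMultilinearMap ℂ (fun _ : Fin (n + 2) => X) ℂ} (h : IsSymmForm φ)
    (z : Bidual X) (p q : X × ℂ) (v : Fin n → Bidual X) :
    spanPoint z p (arensEval (n + 1) (Fin.cons (spanPoint z q) v) ∘L φ.curryLeft) =
      spanPoint z q (arensEval (n + 1) (Fin.cons (spanPoint z p) v) ∘L φ.curryLeft) :=
  arensEval_swap_head h z p q v

/-- The directional derivative of `b ↦ arensEval n (b, …, b) φ` at `v` in the direction `h`, when
the arguments commute. -/
def arensDeriv : (n : ℕ) → (h v : Bidual X) →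
    StrongDual ℂ (ContinuousMultilinearMap ℂ (fun _ : Fin n => X) ℂ)
  | 0, _, _ => 0
  | n + 1, h, v => ((n + 1 : ℕ) : ℂ) • arensEval (n + 1) (Fin.cons h fun _ => v)

theorem arensEval_cons_const (n : ℕ) (b : Bidual X) :
    (Fin.cons b (fun _ => b) : Fin (n + 1) → Bidual X) = fun _ => b := by
  ext i
  refine Fin.cases rfl (fun _ => rfl) i

/-- First-order expansion of the Aron–Berner extension of a symmetric form, on the span of `X` and
one element of the bidual, with a remainder that is uniform on bounded sets. -/
theorem exists_arensEval_taylor_le (n : ℕ) (R : ℝ) : ∃ C : ℝ, 0 ≤ C ∧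
    ∀ φ : ContinuousMultilinearMap ℂ (fun _ : Fin n => X) ℂ, IsSymmForm φ →
    ∀ (z : Bidual X) (p q : X × ℂ) (s : ℂ), ‖spanPoint z p‖ ≤ R →
      ‖spanPoint z p + s • spanPoint z q‖ ≤ R → ‖spanPoint z q‖ ≤ R →
      ‖arensEval n (fun _ => spanPoint z p + s • spanPoint z q) φ
        - arensEval n (fun _ => spanPoint z p) φ
        - s * arensDeriv n (spanPoint z q) (spanPoint z p) φ‖ ≤ C * ‖s‖ ^ 2 * ‖φ‖ := by
  induction n with
  | zero =>
    refine ⟨0, le_rfl, fun φ _ z p q s _ _ _ => ?_⟩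
    have : (fun _ : Fin 0 => spanPoint z p + s • spanPoint z q) = fun _ => spanPoint z p :=
      Subsingleton.elim _ _
    rw [this]
    simp [arensDeriv]
  | succ n ih =>
    obtain ⟨C, hC, h⟩ := ih
    obtain ⟨L, hL, hlip⟩ := exists_arensEval_const_sub_le (X := X) n R
    refine ⟨|R| * C + |R| * L * |R|, by positivity, fun φ hφ z p q s hv hu hh => ?_⟩
    have hR : 0 ≤ R := le_trans (by positivity) hh
    rw [abs_of_nonneg hR]
    set v := spanPoint z p with hv'
    set k := spanPoint z q with hk'
    set u := v + s • k with hu'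
    -- the functional `x ↦` (remainder for `φ (x, ·)`), which is small by induction
    set T : StrongDual ℂ X := (arensEval n (fun _ => u) - arensEval n (fun _ => v)
      - s • arensDeriv n k v) ∘L φ.curryLeft with hT
    have hTn : ‖T‖ ≤ C * ‖s‖ ^ 2 * ‖φ‖ := by
      refine ContinuousLinearMap.opNorm_le_bound _ (by positivity) fun x => ?_
      have := h (φ.curryLeft x) (hφ.curryLeft x) z p q s hv hu hh
      have e : T x = arensEval n (fun _ => u) (φ.curryLeft x)
        - arensEval n (fun _ => v) (φ.curryLeft x) - s * arensDeriv n k v (φ.curryLeft x) := rfl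
      rw [e]
      refine this.trans ?_
      rw [mul_assoc (C * ‖s‖ ^ 2)]
      gcongr
      rw [← φ.curryLeft_norm]
      exact φ.curryLeft.le_opNorm x
    set S : StrongDual ℂ X :=
      (arensEval n (fun _ => u) - arensEval n (fun _ => v)) ∘L φ.curryLeft with hS
    have hSn : ‖S‖ ≤ L * (‖s‖ * R) * ‖φ‖ := by
      refine (ContinuousLinearMap.opNorm_comp_le _ _).trans ?_
      rw [φ.curryLeft_norm]
      gcongr
      refine (hlip u v hu hv).trans ?_
      gcongr
      have e : u - v = s • k := add_sub_cancel_left v _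
      rw [e]
      refine (ContinuousLinearMap.opNorm_smul_le s k).trans ?_
      gcongr
    -- moving the direction `k` to the front of all `n` derivative terms
    have hmove : v (arensDeriv n k v ∘L φ.curryLeft)
        = n * k (arensEval n (fun _ => v) ∘L φ.curryLeft) := by
      cases n with
      | zero => simp [arensDeriv]
      | succ m =>
        simp only [arensDeriv, ContinuousLinearMap.smul_comp, map_smul, smul_eq_mul]
        rw [hv', hk', arensEval_move_head hφ, arensEval_cons_const]
    have e : arensEval (n + 1) (fun _ => u) φ - arensEval (n + 1) (fun _ => v) φ
        - s * arensDeriv (n + 1) k v φ = v T + s * k S := by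
      have h1 : v T = v (arensEval n (fun _ => u) ∘L φ.curryLeft)
          - v (arensEval n (fun _ => v) ∘L φ.curryLeft)
          - s * v (arensDeriv n k v ∘L φ.curryLeft) := by
        simp only [hT, ContinuousLinearMap.sub_comp, ContinuousLinearMap.smul_comp, map_sub,
          map_smul, smul_eq_mul]
      have h2 : k S = k (arensEval n (fun _ => u) ∘L φ.curryLeft)
          - k (arensEval n (fun _ => v) ∘L φ.curryLeft) := by
        simp only [hS, ContinuousLinearMap.sub_comp, map_sub]
      have h3 : arensDeriv (n + 1) k v φ
          = (n + 1) * k (arensEval n (fun _ => v) ∘L φ.curryLeft) := by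
        simp only [arensDeriv, _root_.smul_apply, arensEval_cons_apply, smul_eq_mul]
        push_cast
        rfl
      have h4 : arensEval (n + 1) (fun _ => u) φ
          = v (arensEval n (fun _ => u) ∘L φ.curryLeft)
            + s * k (arensEval n (fun _ => u) ∘L φ.curryLeft) := by
        rw [arensEval_const_succ]
        conv_lhs => enter [1]; rw [hu']
        rfl
      rw [h1, h2, h3, h4, hmove, arensEval_const_succ]
      ring
    rw [e]
    calc _ ≤ R * (C * ‖s‖ ^ 2 * ‖φ‖) + ‖s‖ * (R * (L * (‖s‖ * R) * ‖φ‖)) := by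
          refine norm_add_le_of_le ?_ ?_
          · refine (v.le_opNorm _).trans ?_
            gcongr
          · rw [norm_mul]
            gcongr
            refine (k.le_opNorm _).trans ?_
            gcongr
      _ = _ := by ring

end Arens

/-! ### Weak-star convergence, averages and the theorem of Davie and Gamelin -/

section Averages

variable {X W : Type*} [NormedAddCommGroup X] [NormedSpace ℂ X]
  [NormedAddCommGroup W] [NormedSpace ℂ W]

/-- The filter `F` on `X` converges weak-star to `b`, within the closed unit ball of `X`. -/
structure WeakStarTendsto (F : Filter X) (b : Bidual X) : Prop where
  tendsto : ∀ ψ : StrongDual ℂ X, Tendsto ψ F (𝓝 (b ψ))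
  ball : ∀ᶠ x in F, ‖x‖ ≤ 1

/-- Goldstine's theorem: the unit ball of `X` is weak-star dense in that of the bidual. -/
theorem exists_weakStarTendsto {b : Bidual X} (hb : ‖b‖ ≤ 1) :
    ∃ F : Filter X, F.NeBot ∧ WeakStarTendsto F b := by
  let ev : X → WeakDual ℂ (StrongDual ℂ X) :=
    fun x => StrongDual.toWeakDual (NormedSpace.inclusionInDoubleDual ℂ X x)
  let β : WeakDual ℂ (StrongDual ℂ X) := StrongDual.toWeakDual b
  have hβ : β ∈ closure (ev '' closedBall 0 1) := by
    by_contra hcon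
    have hconv : Convex ℝ (ev '' closedBall 0 1) := by
      rintro _ ⟨x, hx, rfl⟩ _ ⟨y, hy, rfl⟩ r s hr hs hrs
      refine ⟨r • x + s • y, convex_closedBall (0 : X) 1 hx hy hr hs hrs, ?_⟩
      refine DFunLike.ext _ _ fun ψ => ?_
      show ψ (r • x + s • y) = r • ψ x + s • ψ y
      have h1 : ∀ (t : ℝ) (x : X), ψ (t • x) = t • ψ x := by
        intro t x
        rw [← Complex.coe_smul, map_smul, Complex.coe_smul]
      rw [map_add, h1, h1]
    have : LocallyConvexSpace ℝ (WeakDual ℂ (StrongDual ℂ X)) :=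
      WeakBilin.locallyConvexSpace (B := topDualPairing ℂ (StrongDual ℂ X))
    obtain ⟨f, u, hf, hu⟩ := RCLike.geometric_hahn_banach_closed_point (𝕜 := ℂ)
      hconv.closure isClosed_closure hcon
    obtain ⟨ψ, rfl⟩ := LinearMap.dualEmbedding_surjective
      (topDualPairing ℂ (StrongDual ℂ X)) f
    have h1 : ∀ x : X, ‖x‖ ≤ 1 → (ψ x).re < u := fun x hx =>
      hf _ (subset_closure ⟨x, by simpa using hx, rfl⟩)
    have h2 : u < (b ψ).re := hu
    have h3 : ‖ψ‖ ≤ u := by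
      have hu0 : 0 ≤ u := by simpa using (h1 0 (by simp)).le
      refine ContinuousLinearMap.opNorm_le_of_unit_norm hu0 fun x hx => ?_
      -- rotate `x` so that `ψ x` becomes real and nonnegative
      obtain ⟨c, hc, hcx⟩ := Complex.exists_norm_eq_mul_self (ψ x)
      have := h1 (c • x) (by rw [norm_smul, hx, mul_one]; exact hc.le)
      rw [map_smul, smul_eq_mul, ← hcx, Complex.ofReal_re] at this
      exact this.le
    have := (Complex.re_le_norm (b ψ)).trans (b.le_opNorm ψ)
    nlinarith [norm_nonneg ψ]
  refine ⟨comap ev (𝓝 β) ⊓ 𝓟 (closedBall 0 1), ?_, ?_, ?_⟩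
  · rw [← forall_mem_nonempty_iff_neBot]
    intro s hs
    obtain ⟨t, ht, u, hu, rfl⟩ := mem_inf_iff.1 hs
    obtain ⟨V, hV, hVt⟩ := mem_comap.1 ht
    obtain ⟨_, hyV, x, hx, rfl⟩ := mem_closure_iff_nhds.1 hβ V hV
    exact ⟨x, hVt hyV, hu hx⟩
  · intro ψ
    have : Tendsto (fun y : WeakDual ℂ (StrongDual ℂ X) => y ψ) (𝓝 β) (𝓝 (β ψ)) :=
      (WeakDual.eval_continuous ψ).tendsto β
    exact (this.comp tendsto_comap).mono_left inf_le_left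
  · exact mem_inf_of_right (by intro x hx; simpa using hx)

/-- `∑_{j ≤ N} φⱼ(x, …, x)`. -/
def formSum (N : ℕ) (φ : ∀ j : ℕ, ContinuousMultilinearMap ℂ (fun _ : Fin j => X) W) (x : X) : W :=
  ∑ j ∈ Finset.range (N + 1), φ j fun _ => x

/-- The Aron–Berner extension of the scalar polynomial `formSum N φ`. -/
def arensSum (N : ℕ) (φ : ∀ j : ℕ, ContinuousMultilinearMap ℂ (fun _ : Fin j => X) ℂ)
    (b : Bidual X) : ℂ :=
  ∑ j ∈ Finset.range (N + 1), arensEval j (fun _ => b) (φ j)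

theorem arensSum_inclusion (N : ℕ)
    (φ : ∀ j : ℕ, ContinuousMultilinearMap ℂ (fun _ : Fin j => X) ℂ) (x : X) :
    arensSum N φ (NormedSpace.inclusionInDoubleDual ℂ X x) = formSum N φ x := by
  simp only [arensSum, formSum, ← arensEval_inclusion]

theorem norm_spanPoint_le {z : Bidual X} (hz : ‖z‖ ≤ 1) (p : X × ℂ) :
    ‖spanPoint z p‖ ≤ ‖p.1‖ + ‖p.2‖ := by
  refine (norm_add_le _ _).trans (add_le_add (NormedSpace.double_dual_bound ℂ X p.1) ?_)
  rw [norm_smul]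
  exact mul_le_of_le_one_right (norm_nonneg _) hz

theorem tendsto_arensDeriv {F : Filter X} {z : Bidual X} (hF : WeakStarTendsto F z) (n : ℕ)
    (φ : ContinuousMultilinearMap ℂ (fun _ : Fin n => X) ℂ) (v : Bidual X) :
    Tendsto (fun x => arensDeriv n (spanPoint z (x, -1)) v φ) F (𝓝 0) := by
  cases n with
  | zero => simpa [arensDeriv] using tendsto_const_nhds
  | succ n =>
    simp only [arensDeriv, _root_.smul_apply, arensEval_cons_apply, spanPoint]
    have h := hF.tendsto (arensEval n (fun _ => v) ∘L φ.curryLeft)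
    have h2 := (h.sub_const (z (arensEval n (fun _ => v) ∘L φ.curryLeft))).const_smul
      ((n + 1 : ℕ) : ℂ)
    rw [sub_self, smul_zero] at h2
    refine h2.congr fun x => ?_
    rw [neg_one_smul, ← sub_eq_add_neg, _root_.sub_apply, NormedSpace.dual_def]

/-- Replacing a multiple `s z` of a point of the bidual by `s x`, with `x` weak-star close to `z`,
changes the Aron–Berner extension of a polynomial by `O(s²)` only. -/
theorem exists_eventually_arensSum_sub_le (N : ℕ)
    (φ : ∀ j : ℕ, ContinuousMultilinearMap ℂ (fun _ : Fin j => X) ℂ) (hφ : ∀ j, IsSymmForm (φ j)) :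
    ∃ C : ℝ, 0 ≤ C ∧ ∀ (F : Filter X) (z : Bidual X), ‖z‖ ≤ 1 → WeakStarTendsto F z →
      ∀ (a : X) (t s : ℝ), ‖a‖ ≤ 1 → |t| ≤ 1 → 0 < s → s ≤ 1 →
        ∀ᶠ x in F, ‖arensSum N φ (spanPoint z (a + (s : ℂ) • x, (t - s : ℂ)))
          - arensSum N φ (spanPoint z (a, (t : ℂ)))‖ ≤ C * s ^ 2 := by
  choose C hC h using fun j : ℕ => exists_arensEval_taylor_le (X := X) j 4
  refine ⟨(∑ j ∈ Finset.range (N + 1), C j * ‖φ j‖) + 1,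
    add_nonneg (Finset.sum_nonneg fun j _ => mul_nonneg (hC j) (norm_nonneg _)) zero_le_one,
    fun F z hz hF a t s ha ht hs hs1 => ?_⟩
  have hlim : Tendsto (fun x => ∑ j ∈ Finset.range (N + 1),
      arensDeriv j (spanPoint z (x, -1)) (spanPoint z (a, (t : ℂ))) (φ j)) F (𝓝 0) := by
    simpa using tendsto_finsetSum (Finset.range (N + 1)) fun j _ =>
      tendsto_arensDeriv hF j (φ j) (spanPoint z (a, (t : ℂ)))
  filter_upwards [hF.ball, (Metric.tendsto_nhds.1 hlim) s hs] with x hx hd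
  rw [dist_zero_right] at hd
  have e : spanPoint z (a + (s : ℂ) • x, (t - s : ℂ))
      = spanPoint z (a, (t : ℂ)) + (s : ℂ) • spanPoint z (x, -1) := by
    simp only [spanPoint, map_add, map_smul]
    module
  have hns : ‖(s : ℂ)‖ = s := by rw [Complex.norm_real, Real.norm_of_nonneg hs.le]
  have hnt : ‖(t : ℂ)‖ ≤ 1 := by rwa [Complex.norm_real, Real.norm_eq_abs]
  have b1 : ‖spanPoint z (a, (t : ℂ))‖ ≤ 4 := (norm_spanPoint_le hz _).trans (by
    show ‖a‖ + ‖(t : ℂ)‖ ≤ 4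
    linarith)
  have b2 : ‖spanPoint z (x, -1)‖ ≤ 2 := (norm_spanPoint_le hz _).trans (by
    show ‖x‖ + ‖(-1 : ℂ)‖ ≤ 2
    rw [norm_neg, norm_one]
    linarith)
  have b3 : ‖spanPoint z (a, (t : ℂ)) + (s : ℂ) • spanPoint z (x, -1)‖ ≤ 4 := by
    rw [← e]
    refine (norm_spanPoint_le hz _).trans ?_
    show ‖a + (s : ℂ) • x‖ + ‖(t - s : ℂ)‖ ≤ 4
    have h1 : ‖a + (s : ℂ) • x‖ ≤ 1 + 1 := norm_add_le_of_le ha (by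
      rw [norm_smul, hns]
      exact mul_le_one₀ hs1 (norm_nonneg _) hx)
    have h2 : ‖(t - s : ℂ)‖ ≤ 1 + 1 := norm_sub_le_of_le hnt (by rw [hns]; exact hs1)
    linarith
  rw [e]
  have key : arensSum N φ (spanPoint z (a, (t : ℂ)) + (s : ℂ) • spanPoint z (x, -1))
      - arensSum N φ (spanPoint z (a, (t : ℂ)))
      = (∑ j ∈ Finset.range (N + 1),
          (arensEval j (fun _ => spanPoint z (a, (t : ℂ)) + (s : ℂ) • spanPoint z (x, -1)) (φ j)
            - arensEval j (fun _ => spanPoint z (a, (t : ℂ))) (φ j)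
            - s * arensDeriv j (spanPoint z (x, -1)) (spanPoint z (a, (t : ℂ))) (φ j)))
        + s * ∑ j ∈ Finset.range (N + 1),
          arensDeriv j (spanPoint z (x, -1)) (spanPoint z (a, (t : ℂ))) (φ j) := by
    simp only [arensSum, Finset.sum_sub_distrib, Finset.mul_sum]
    ring
  rw [key]
  calc _ ≤ (∑ j ∈ Finset.range (N + 1), C j * ‖φ j‖ * s ^ 2) + s * s := by
        refine norm_add_le_of_le (norm_sum_le_of_le _ fun j _ => ?_) ?_
        · have := h j (φ j) (hφ j) z (a, (t : ℂ)) (x, -1) s b1 b3 (b2.trans (by norm_num))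
          rw [hns] at this
          linarith
        · rw [norm_mul, hns]
          exact mul_le_mul_of_nonneg_left hd.le hs.le
    _ = _ := by rw [← Finset.sum_mul]; ring

/-- The Aron–Berner extension at `z` is approximated by values of the polynomial at averages
`(x₁ + ⋯ + x_M) / M`, where each `xᵢ` is chosen weak-star close to `z` after its predecessors.
An invariant `Q` that holds at `0`, and frequently passes from a partial sum to the next one, can
be imposed on the partial sums. -/
theorem exists_average_near_arensSum (N : ℕ)
    (φ : ∀ j : ℕ, ContinuousMultilinearMap ℂ (fun _ : Fin j => X) ℂ) (hφ : ∀ j, IsSymmForm (φ j)) :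
    ∃ C : ℝ, 0 ≤ C ∧ ∀ (F : Filter X) (z : Bidual X), ‖z‖ ≤ 1 → WeakStarTendsto F z →
      ∀ (M : ℕ), 0 < M → ∀ Q : ℕ → X → Prop, Q 0 0 →
        (∀ r < M, ∀ a : X, ‖a‖ ≤ r / M → Q r a →
          ∃ᶠ x in F, Q (r + 1) (a + ((1 / M : ℝ) : ℂ) • x)) →
        ∃ a : X, ‖a‖ ≤ 1 ∧ Q M a ∧ ‖formSum N φ a - arensSum N φ z‖ ≤ C / M := by
  obtain ⟨C, hC, h⟩ := exists_eventually_arensSum_sub_le N φ hφ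
  refine ⟨C, hC, fun F z hz hF M hM Q h0 hQ => ?_⟩
  have hM' : (0 : ℝ) < M := by exact_mod_cast hM
  have hM1 : (1 : ℝ) ≤ M := by exact_mod_cast hM
  have claim : ∀ r ≤ M, ∃ a : X, ‖a‖ ≤ r / M ∧ Q r a ∧
      ‖arensSum N φ (spanPoint z (a, ((1 - r / M : ℝ) : ℂ))) - arensSum N φ z‖
        ≤ r * (C * (1 / M) ^ 2) := by
    intro r
    induction r with
    | zero =>
      intro _
      refine ⟨0, by simp, h0, ?_⟩
      simp [spanPoint]
    | succ r ih =>
      intro hr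
      obtain ⟨a, ha, hQa, hd⟩ := ih (by omega)
      have hrM : (r : ℝ) + 1 ≤ M := by exact_mod_cast hr
      have hr1 : (r : ℝ) / M ≤ 1 := (div_le_one hM').2 (by linarith)
      have hr0 : 0 ≤ (r : ℝ) / M := by positivity
      obtain ⟨x, hx, hx2, hx1⟩ := ((hQ r (by omega) a ha hQa).and_eventually
        ((h F z hz hF a (1 - r / M) (1 / M) (ha.trans hr1)
          (abs_le.2 ⟨by linarith, by linarith⟩) (by positivity)
          ((div_le_one hM').2 hM1)).and hF.ball)).exists
      refine ⟨_, ?_, hx, ?_⟩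
      · have : ‖((1 / M : ℝ) : ℂ) • x‖ ≤ 1 / M := by
          rw [norm_smul, Complex.norm_real, Real.norm_of_nonneg (by positivity)]
          exact mul_le_of_le_one_right (by positivity) hx1
        refine (norm_add_le_of_le ha this).trans (le_of_eq ?_)
        push_cast
        ring
      · have e : ((1 - (r + 1 : ℕ) / M : ℝ) : ℂ) = ((1 - r / M : ℝ) : ℂ) - ((1 / M : ℝ) : ℂ) := by
          push_cast
          ring
        rw [e]
        have := norm_add_le_of_le hx2 hd
        rw [sub_add_sub_cancel] at this
        refine this.trans (le_of_eq ?_)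
        push_cast
        ring
  obtain ⟨a, ha, hQa, hd⟩ := claim M le_rfl
  rw [div_self hM'.ne'] at ha hd
  refine ⟨a, ha, hQa, ?_⟩
  have e : spanPoint z (a, ((1 - 1 : ℝ) : ℂ)) = NormedSpace.inclusionInDoubleDual ℂ X a := by
    simp [spanPoint]
  rw [e, arensSum_inclusion] at hd
  refine hd.trans (le_of_eq ?_)
  field_simp

/-- The theorem of Davie and Gamelin: the Aron–Berner extension of a polynomial has the same
bound on the unit ball of the bidual as the polynomial has on the unit ball. -/
theorem norm_arensSum_le (N : ℕ)
    (φ : ∀ j : ℕ, ContinuousMultilinearMap ℂ (fun _ : Fin j => X) ℂ) (hφ : ∀ j, IsSymmForm (φ j))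
    {K : ℝ} (hK : ∀ x : X, ‖x‖ ≤ 1 → ‖formSum N φ x‖ ≤ K) {b : Bidual X} (hb : ‖b‖ ≤ 1) :
    ‖arensSum N φ b‖ ≤ K := by
  obtain ⟨C, hC, h⟩ := exists_average_near_arensSum N φ hφ
  obtain ⟨F, hF, hFb⟩ := exists_weakStarTendsto hb
  refine le_of_forall_pos_le_add fun ε hε => ?_
  obtain ⟨M, hM⟩ := exists_nat_gt (C / ε)
  have hM0 : (0 : ℝ) < M := lt_of_le_of_lt (by positivity) hM
  obtain ⟨a, ha, -, hd⟩ := h F b hb hFb M (by exact_mod_cast hM0) (fun _ _ => True) trivial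
    fun _ _ _ _ _ => Frequently.of_forall fun _ => trivial
  have h1 : C / M < ε := by
    rw [div_lt_iff₀ hε] at hM
    rw [div_lt_iff₀ hM0]
    linarith
  have h2 := norm_le_norm_add_norm_sub (formSum N φ a) (arensSum N φ b)
  linarith [hK a ha]

end Averages

/-! ### Generic perturbations -/

section Generic

/-- A set that contains a ball arbitrarily close to every point. -/
def ContainsBallsEverywhere {E : Type*} [NormedAddCommGroup E] (A : Set E) : Prop :=
  ∀ (P : E) (δ : ℝ), 0 < δ → ∃ P' : E, ‖P' - P‖ < δ ∧ ∃ ρ : ℝ, 0 < ρ ∧ ball P' ρ ⊆ A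

theorem ContainsBallsEverywhere.dense_interior {E : Type*} [NormedAddCommGroup E] {A : Set E}
    (h : ContainsBallsEverywhere A) : Dense (interior A) := by
  refine Metric.dense_iff.2 fun P δ hδ => ?_
  obtain ⟨P', hP', ρ, hρ, hA⟩ := h P δ hδ
  exact ⟨P', by rwa [mem_ball_iff_norm], interior_maximal hA isOpen_ball (mem_ball_self hρ)⟩

variable {S E W : Type*} [NormedAddCommGroup E] [NormedSpace ℂ E]
  [NormedAddCommGroup W] [NormedSpace ℂ W]

/-- The supremum seminorm of an element of a space `E` of `W`-valued functions on `S`, where the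
functions are given by the evaluations `ev`. -/
def supSeminorm (ev : S → E →L[ℂ] W) (P : E) : ℝ := ⨆ x, ‖ev x P‖

/-- The points of `S` at which the norm of `P` is within `η` of its supremum. -/
def nearMax (ev : S → E →L[ℂ] W) (P : E) (η : ℝ) : Set S :=
  {x | supSeminorm ev P - η ≤ ‖ev x P‖}

/-- The rank-one functions `x ↦ r x • y` belong to `E`, with control of the norm. -/
def IsMultiplier (ev : S → E →L[ℂ] W) (r : S → ℂ) (K : ℝ) : Prop :=
  ∀ y : W, ∃ R : E, (∀ x, ev x R = r x • y) ∧ ‖R‖ ≤ K * ‖y‖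

variable {ev : S → E →L[ℂ] W}

theorem norm_ev_le (hev : ∀ x, ‖ev x‖ ≤ 1) (x : S) (P : E) : ‖ev x P‖ ≤ ‖P‖ :=
  ((ev x).le_of_opNorm_le (hev x) P).trans_eq (one_mul _)

theorem norm_ev_le_supSeminorm (hev : ∀ x, ‖ev x‖ ≤ 1) (x : S) (P : E) :
    ‖ev x P‖ ≤ supSeminorm ev P :=
  le_ciSup (f := fun x => ‖ev x P‖) ⟨‖P‖, by rintro _ ⟨x, rfl⟩; exact norm_ev_le hev x P⟩ x

theorem nearMax_nonempty [Nonempty S] (P : E) {η : ℝ} (hη : 0 < η) :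
    (nearMax ev P η).Nonempty := by
  obtain ⟨x, hx⟩ := exists_lt_of_lt_ciSup (show supSeminorm ev P - η < ⨆ x, ‖ev x P‖ from
    sub_lt_self _ hη)
  exact ⟨x, hx.le⟩

theorem nearMax_mono (P : E) {η η' : ℝ} (h : η ≤ η') : nearMax ev P η ⊆ nearMax ev P η' :=
  fun _ hx => (sub_le_sub_left h _).trans hx

theorem supSeminorm_le_add [Nonempty S] (hev : ∀ x, ‖ev x‖ ≤ 1) (P P' : E) :
    supSeminorm ev P ≤ supSeminorm ev P' + ‖P - P'‖ := by
  refine ciSup_le fun x => ?_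
  have h1 := norm_ev_le hev x (P - P')
  rw [map_sub] at h1
  have h2 := norm_le_norm_add_norm_sub' (ev x P) (ev x P')
  have h3 := norm_ev_le_supSeminorm hev x P'
  linarith

theorem nearMax_subset [Nonempty S] (hev : ∀ x, ‖ev x‖ ≤ 1) {P P' : E} {ρ η η' : ℝ}
    (h : ‖P - P'‖ ≤ ρ) (hη : η + 2 * ρ ≤ η') : nearMax ev P η ⊆ nearMax ev P' η' := by
  intro x hx
  change supSeminorm ev P - η ≤ ‖ev x P‖ at hx
  change supSeminorm ev P' - η' ≤ ‖ev x P'‖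
  have h1 := norm_ev_le hev x (P - P')
  rw [map_sub] at h1
  have h2 := norm_le_norm_add_norm_sub' (ev x P) (ev x P')
  have h3 := supSeminorm_le_add hev P' P
  rw [norm_sub_rev] at h3
  linarith

/-- Every vector is norm-additive with multiples of some unit vector. -/
theorem exists_unit_norm_add [Nontrivial W] (u : W) :
    ∃ y : W, ‖y‖ = 1 ∧ ∀ t : ℝ, 0 ≤ t → ‖u + (t : ℂ) • y‖ = ‖u‖ + t := by
  by_cases hu : u = 0
  · obtain ⟨v, hv⟩ := exists_ne (0 : W)
    have hv' : ‖v‖ ≠ 0 := norm_ne_zero_iff.2 hv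
    have h1 : ‖((‖v‖⁻¹ : ℝ) : ℂ) • v‖ = 1 := by
      rw [norm_smul, Complex.norm_real, Real.norm_of_nonneg (by positivity), inv_mul_cancel₀ hv']
    refine ⟨_, h1, fun t ht => ?_⟩
    rw [hu, zero_add, norm_smul, h1, Complex.norm_real, Real.norm_of_nonneg ht, norm_zero]
    ring
  · have hu' : ‖u‖ ≠ 0 := norm_ne_zero_iff.2 hu
    refine ⟨((‖u‖⁻¹ : ℝ) : ℂ) • u, ?_, fun t ht => ?_⟩
    · rw [norm_smul, Complex.norm_real, Real.norm_of_nonneg (by positivity), inv_mul_cancel₀ hu']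
    · have : u + (t : ℂ) • ((‖u‖⁻¹ : ℝ) : ℂ) • u = ((1 + t * ‖u‖⁻¹ : ℝ) : ℂ) • u := by
        push_cast
        module
      rw [this, norm_smul, Complex.norm_real, Real.norm_of_nonneg (by positivity)]
      field_simp

/-- A small perturbation of `P` makes a multiplier `r` at least as large, up to `δ`, at all almost
maximizers of the perturbed function as it is at a given almost maximizer `x` of `P`. The required
quality of `x` does not depend on `r`, so that `r` may depend on `x`. -/
theorem exists_perturbation [Nonempty S] [Nontrivial W] (hev : ∀ x, ‖ev x‖ ≤ 1) (P : E) {δ K : ℝ}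
    (hδ : 0 < δ) (hK : 0 ≤ K) :
    ∃ η₀ : ℝ, 0 < η₀ ∧ ∀ r : S → ℂ, IsMultiplier ev r K → ∀ x ∈ nearMax ev P η₀,
      ∃ P' : E, ‖P' - P‖ < δ ∧ ∃ η : ℝ, 0 < η ∧ ∀ x' ∈ nearMax ev P' η, ‖r x‖ - δ ≤ ‖r x'‖ := by
  set ε : ℝ := δ / (K + 1) with hε
  have hε0 : 0 < ε := by positivity
  have hεK : ε * K < δ := by
    rw [hε, div_mul_eq_mul_div, div_lt_iff₀ (by positivity)]
    nlinarith
  refine ⟨ε * δ / 2, by positivity, fun r hr x hx => ?_⟩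
  obtain ⟨y, hy, hyx⟩ := exists_unit_norm_add (ev x P)
  obtain ⟨θ, hθ, hθr⟩ := Complex.exists_norm_eq_mul_self (r x)
  -- `R = ε θ r • y` is aligned with `P` at `x`, so that adding it gains the full `ε ‖r x‖` there
  obtain ⟨R, hR, hRn⟩ := hr (((ε : ℂ) * θ) • y)
  have hεn : ‖(ε : ℂ)‖ = ε := by rw [Complex.norm_real, Real.norm_of_nonneg hε0.le]
  have hyn : ‖((ε : ℂ) * θ) • y‖ = ε := by rw [norm_smul, norm_mul, hθ, hy, hεn]; ring
  refine ⟨P + R, ?_, ε * δ / 2, by positivity, fun x' hx' => ?_⟩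
  · rw [add_sub_cancel_left]
    rw [hyn] at hRn
    linarith
  have h1 : ‖ev x (P + R)‖ = ‖ev x P‖ + ε * ‖r x‖ := by
    rw [← hyx _ (by positivity), map_add, hR, smul_smul]
    congr 3
    push_cast
    rw [hθr]
    ring
  have h2 : ‖ev x' (P + R)‖ ≤ ‖ev x' P‖ + ε * ‖r x'‖ := by
    rw [map_add, hR]
    refine norm_add_le_of_le le_rfl ?_
    rw [norm_smul, hyn, mul_comm]
  have h3 := norm_ev_le_supSeminorm hev x (P + R)
  have h4 := norm_ev_le_supSeminorm hev x' P
  have h5 : supSeminorm ev P - ε * δ / 2 ≤ ‖ev x P‖ := hx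
  have h6 : supSeminorm ev (P + R) - ε * δ / 2 ≤ ‖ev x' (P + R)‖ := hx'
  have h7 : ε * (‖r x‖ - δ) ≤ ε * ‖r x'‖ := by linarith
  exact le_of_mul_le_mul_left h7 hε0

/-- Generically, some functional of a norming sequence is almost norming at all almost
maximizers. -/
theorem containsBallsEverywhere_norming [Nonempty S] [Nontrivial W] (hev : ∀ x, ‖ev x‖ ≤ 1)
    (D : ℕ → StrongDual ℂ W) (hD1 : ∀ i, ‖D i‖ ≤ 1)
    (hD : ∀ (y : W) (δ : ℝ), 0 < δ → ∃ i, ‖y‖ - δ ≤ ‖D i y‖)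
    (hmul : ∀ i P, IsMultiplier ev (fun x => D i (ev x P)) ‖P‖) {κ : ℝ} (hκ : 0 < κ) :
    ContainsBallsEverywhere {P : E | ∃ i, ∃ η : ℝ, 0 < η ∧
      ∀ x ∈ nearMax ev P η, supSeminorm ev P - κ ≤ ‖D i (ev x P)‖} := by
  intro P δ hδ
  set γ := min δ (κ / 8) with hγ
  have hγ0 : 0 < γ := by positivity
  have hγκ : γ ≤ κ / 8 := min_le_right _ _
  obtain ⟨η₀, hη₀, hpert⟩ := exists_perturbation hev P hγ0 (norm_nonneg P)
  obtain ⟨x, hx⟩ := nearMax_nonempty (ev := ev) P (lt_min hη₀ hγ0)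
  obtain ⟨i, hi⟩ := hD (ev x P) γ hγ0
  obtain ⟨P', hP', η, hη, h⟩ := hpert _ (hmul i P) x (nearMax_mono P (min_le_left _ _) hx)
  have hxγ : supSeminorm ev P - γ ≤ ‖ev x P‖ := nearMax_mono P (min_le_right _ _) hx
  refine ⟨P', hP'.trans_le (min_le_left _ _), min (η / 4) γ, by positivity, fun P'' hP'' => ?_⟩
  rw [mem_ball_iff_norm] at hP''
  have hd1 : ‖P'' - P'‖ ≤ η / 4 := hP''.le.trans (min_le_left _ _)
  have hd2 : ‖P'' - P'‖ ≤ γ := hP''.le.trans (min_le_right _ _)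
  have hd : ‖P'' - P‖ ≤ γ + γ := by
    have := norm_add_le_of_le hd2 hP'.le
    rwa [sub_add_sub_cancel] at this
  refine ⟨i, η / 2, by positivity, fun x' hx' => ?_⟩
  have h1 := h x' (nearMax_subset hev hd1 (by linarith) hx')
  have h2 : ‖D i (ev x' (P'' - P))‖ ≤ γ + γ :=
    ((D i).le_of_opNorm_le (hD1 i) _).trans ((one_mul _).trans_le ((norm_ev_le hev x' _).trans hd))
  rw [map_sub, map_sub] at h2
  have h3 := norm_le_norm_add_norm_sub (D i (ev x' P'')) (D i (ev x' P))
  have h4 := supSeminorm_le_add hev P'' P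
  linarith

/-- Generically, there are almost maximizers `x` such that replacing a part of `x` by any other
almost maximizer does not essentially decrease the modulus of a functional of `P`. Here `τ x x'`
stands for the evaluation at a combination of `x` and `x'`. -/
theorem containsBallsEverywhere_replace [Nonempty S] [Nontrivial W] (hev : ∀ x, ‖ev x‖ ≤ 1)
    (w : StrongDual ℂ W) (hw : ‖w‖ ≤ 1) (τ : S → S → E →L[ℂ] W) (B : ℝ) (hB : 0 ≤ B)
    (hτ : ∀ x x', ‖τ x x'‖ ≤ B)
    (hmul : ∀ x P, IsMultiplier ev (fun x' => w (τ x x' P)) (B * ‖P‖)) {κ : ℝ} (hκ : 0 < κ) :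
    ContainsBallsEverywhere {P : E | ∃ x ∈ nearMax ev P κ, ∃ η : ℝ, 0 < η ∧
      ∀ x' ∈ nearMax ev P η, ‖w (τ x x P)‖ - κ ≤ ‖w (τ x x' P)‖} := by
  intro P δ hδ
  set γ := min δ (κ / (8 * (B + 1))) with hγ
  have hγ0 : 0 < γ := by positivity
  have hγκ : γ * (B + 1) ≤ κ / 8 := by
    have : γ ≤ κ / (8 * (B + 1)) := min_le_right _ _
    rw [le_div_iff₀ (by positivity)] at this
    linarith
  have hγκ' : γ ≤ κ / 8 := by nlinarith
  obtain ⟨η₀, hη₀, hpert⟩ := exists_perturbation hev P hγ0 (mul_nonneg hB (norm_nonneg P))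
  obtain ⟨x, hx⟩ := nearMax_nonempty (ev := ev) P (lt_min hη₀ hγ0)
  obtain ⟨P', hP', η, hη, h⟩ := hpert _ (hmul x P) x (nearMax_mono P (min_le_left _ _) hx)
  refine ⟨P', hP'.trans_le (min_le_left _ _), min (η / 4) γ, by positivity, fun P'' hP'' => ?_⟩
  rw [mem_ball_iff_norm] at hP''
  have hd1 : ‖P'' - P'‖ ≤ η / 4 := hP''.le.trans (min_le_left _ _)
  have hd2 : ‖P'' - P'‖ ≤ γ := hP''.le.trans (min_le_right _ _)
  have hd : ‖P'' - P‖ ≤ γ + γ := by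
    have := norm_add_le_of_le hd2 hP'.le
    rwa [sub_add_sub_cancel] at this
  have hxm : x ∈ nearMax ev P'' κ := by
    refine nearMax_subset hev (ρ := γ + γ) (η := γ) (by rwa [norm_sub_rev]) (by linarith)
      (nearMax_mono P (min_le_right _ _) hx)
  refine ⟨x, hxm, η / 2, by positivity, fun x' hx' => ?_⟩
  have h1 := h x' (nearMax_subset hev hd1 (by linarith) hx')
  have h2 : ∀ x', ‖w (τ x x' P'') - w (τ x x' P)‖ ≤ B * (γ + γ) := by
    intro x'
    rw [← map_sub, ← map_sub]
    refine (w.le_of_opNorm_le hw _).trans ((one_mul _).trans_le ?_)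
    exact ((τ x x').le_of_opNorm_le (hτ x x') _).trans (mul_le_mul_of_nonneg_left hd hB)
  have h3 := norm_le_norm_add_norm_sub (w (τ x x' P'')) (w (τ x x' P))
  have h4 := norm_le_norm_add_norm_sub' (w (τ x x P'')) (w (τ x x P))
  have h5 := h2 x'
  have h6 := h2 x
  linarith

/-- Generically, the modulus of a multiplier is almost constant on the set of almost
maximizers. -/
theorem containsBallsEverywhere_constant [Nonempty S] [Nontrivial W] (hev : ∀ x, ‖ev x‖ ≤ 1)
    (q : S → ℂ) (K : ℝ) (hK : 0 ≤ K) (hmul : IsMultiplier ev q K) {κ : ℝ} (hκ : 0 < κ) :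
    ContainsBallsEverywhere {P : E | ∃ η : ℝ, 0 < η ∧
      ∀ x ∈ nearMax ev P η, ∀ x' ∈ nearMax ev P η, |‖q x‖ - ‖q x'‖| ≤ κ} := by
  intro P δ hδ
  -- the lower bounds of `‖q ·‖` on almost maximizers that are forced by functions close to `P`
  set V : Set ℝ := {c | ∃ P' : E, ‖P' - P‖ < δ ∧ ∃ η : ℝ, 0 < η ∧
    ∀ x ∈ nearMax ev P' η, c ≤ ‖q x‖} with hV
  have hqK : ∀ x, ‖q x‖ ≤ K := by
    intro x
    obtain ⟨y, hy, -⟩ := exists_unit_norm_add (0 : W)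
    obtain ⟨R, hR, hRn⟩ := hmul y
    have := norm_ev_le hev x R
    rw [hR, norm_smul, hy, mul_one] at this
    rw [hy, mul_one] at hRn
    exact this.trans hRn
  have hbdd : BddAbove V := by
    refine ⟨K, ?_⟩
    rintro c ⟨P', -, η, hη, h⟩
    obtain ⟨x, hx⟩ := nearMax_nonempty (ev := ev) P' hη
    exact (h x hx).trans (hqK x)
  have hne : V.Nonempty := ⟨0, P, by simpa using hδ, 1, one_pos, fun x _ => norm_nonneg _⟩
  obtain ⟨c, ⟨P', hP', η, hη, hc⟩, hcV⟩ := exists_lt_of_lt_csSup hne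
    (show sSup V - κ / 2 < sSup V by linarith)
  obtain ⟨η₀, hη₀, hpert⟩ := exists_perturbation hev P'
    (lt_min (sub_pos.2 hP') (half_pos hκ)) hK
  have hup : ∀ x ∈ nearMax ev P' η₀, ‖q x‖ ≤ sSup V + κ / 2 := by
    intro x hx
    obtain ⟨P'', hP'', η', hη', h⟩ := hpert q hmul x hx
    have hmem : ‖q x‖ - min (δ - ‖P' - P‖) (κ / 2) ∈ V := by
      refine ⟨P'', ?_, η', hη', h⟩
      have h1 := norm_sub_le_norm_sub_add_norm_sub P'' P' P
      have h2 := hP''.trans_le (min_le_left _ _)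
      linarith
    have h1 := le_csSup hbdd hmem
    have h2 : min (δ - ‖P' - P‖) (κ / 2) ≤ κ / 2 := min_le_right _ _
    linarith
  set ζ := min η η₀ with hζ
  have hζ0 : 0 < ζ := lt_min hη hη₀
  refine ⟨P', hP', ζ / 4, by positivity, fun P'' hP'' => ⟨ζ / 2, by positivity, ?_⟩⟩
  rw [mem_ball_iff_norm] at hP''
  have hb : ∀ x ∈ nearMax ev P'' (ζ / 2), sSup V - κ / 2 ≤ ‖q x‖ ∧ ‖q x‖ ≤ sSup V + κ / 2 := by
    intro x hx
    have hx' : x ∈ nearMax ev P' ζ := nearMax_subset hev hP''.le (by linarith) hx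
    exact ⟨hcV.le.trans (hc x (nearMax_mono _ (min_le_left _ _) hx')),
      hup x (nearMax_mono _ (min_le_right _ _) hx')⟩
  intro x hx x' hx'
  have h1 := hb x hx
  have h2 := hb x' hx'
  exact abs_le.2 ⟨by linarith, by linarith⟩

/-- The generic behaviour, with respect to countably many conditions, of the almost maximizers of
elements of a complete space of functions. Baire's theorem is applied to the interiors of the three
families of sets above. -/
theorem exists_generic [CompleteSpace E] [Nonempty S] [Nontrivial W] (hev : ∀ x, ‖ev x‖ ≤ 1)
    {ι κ : Type*} [Countable ι] [Countable κ]
    (D : ℕ → StrongDual ℂ W) (hD1 : ∀ i, ‖D i‖ ≤ 1)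
    (hD : ∀ (y : W) (δ : ℝ), 0 < δ → ∃ i, ‖y‖ - δ ≤ ‖D i y‖)
    (hDmul : ∀ i P, IsMultiplier ev (fun x => D i (ev x P)) ‖P‖)
    (τ : κ → S → S → E →L[ℂ] W) (B : κ → ℝ) (hB : ∀ k, 0 ≤ B k)
    (hτ : ∀ k x x', ‖τ k x x'‖ ≤ B k)
    (hτmul : ∀ i k x P, IsMultiplier ev (fun x' => D i (τ k x x' P)) (B k * ‖P‖))
    (q : ι → S → ℂ) (K : ι → ℝ) (hK : ∀ j, 0 ≤ K j) (hqmul : ∀ j, IsMultiplier ev (q j) (K j))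
    (P₀ : E) {δ : ℝ} (hδ : 0 < δ) :
    ∃ P : E, ‖P - P₀‖ < δ ∧
      (∀ ε : ℝ, 0 < ε → ∃ i, ∃ η : ℝ, 0 < η ∧
        ∀ x ∈ nearMax ev P η, supSeminorm ev P - ε ≤ ‖D i (ev x P)‖) ∧
      (∀ i k, ∀ ε : ℝ, 0 < ε → ∃ x ∈ nearMax ev P ε, ∃ η : ℝ, 0 < η ∧
        ∀ x' ∈ nearMax ev P η, ‖D i (τ k x x P)‖ - ε ≤ ‖D i (τ k x x' P)‖) ∧
      (∀ j, ∀ ε : ℝ, 0 < ε → ∃ η : ℝ, 0 < η ∧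
        ∀ x ∈ nearMax ev P η, ∀ x' ∈ nearMax ev P η, |‖q j x‖ - ‖q j x'‖| ≤ ε) := by
  have d1 : Dense (⋂ n : ℕ, interior {P : E | ∃ i, ∃ η : ℝ, 0 < η ∧
      ∀ x ∈ nearMax ev P η, supSeminorm ev P - 1 / ((n : ℝ) + 1) ≤ ‖D i (ev x P)‖}) :=
    dense_iInter_of_isOpen (fun _ => isOpen_interior) fun n =>
      (containsBallsEverywhere_norming hev D hD1 hD hDmul Nat.one_div_pos_of_nat).dense_interior
  have d2 : Dense (⋂ p : ℕ × κ × ℕ, interior {P : E | ∃ x ∈ nearMax ev P (1 / ((p.2.2 : ℝ) + 1)),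
      ∃ η : ℝ, 0 < η ∧ ∀ x' ∈ nearMax ev P η,
        ‖D p.1 (τ p.2.1 x x P)‖ - 1 / ((p.2.2 : ℝ) + 1) ≤ ‖D p.1 (τ p.2.1 x x' P)‖}) :=
    dense_iInter_of_isOpen (fun _ => isOpen_interior) fun p =>
      (containsBallsEverywhere_replace hev (D p.1) (hD1 _) (τ p.2.1) (B p.2.1) (hB _)
        (hτ _) (hτmul p.1 p.2.1) Nat.one_div_pos_of_nat).dense_interior
  have d3 : Dense (⋂ p : ι × ℕ, interior {P : E | ∃ η : ℝ, 0 < η ∧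
      ∀ x ∈ nearMax ev P η, ∀ x' ∈ nearMax ev P η,
        |‖q p.1 x‖ - ‖q p.1 x'‖| ≤ 1 / ((p.2 : ℝ) + 1)}) :=
    dense_iInter_of_isOpen (fun _ => isOpen_interior) fun p =>
      (containsBallsEverywhere_constant hev (q p.1) (K p.1) (hK _) (hqmul _)
        Nat.one_div_pos_of_nat).dense_interior
  have d12 := d1.inter_of_Gδ (IsGδ.iInter fun _ => isOpen_interior.isGδ)
    (IsGδ.iInter fun _ => isOpen_interior.isGδ) d2
  have d123 := d12.inter_of_Gδ ((IsGδ.iInter fun _ => isOpen_interior.isGδ).inter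
    (IsGδ.iInter fun _ => isOpen_interior.isGδ)) (IsGδ.iInter fun _ => isOpen_interior.isGδ) d3
  obtain ⟨P, hP, ⟨h1, h2⟩, h3⟩ := Metric.dense_iff.1 d123 P₀ δ hδ
  rw [Set.mem_iInter] at h1 h2 h3
  refine ⟨P, by rwa [mem_ball_iff_norm] at hP, fun ε hε => ?_, fun i k ε hε => ?_, fun j ε hε => ?_⟩
  · obtain ⟨n, hn⟩ := exists_nat_one_div_lt hε
    obtain ⟨i, η, hη, h⟩ := interior_subset (h1 n)
    exact ⟨i, η, hη, fun x hx => by linarith [h x hx]⟩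
  · obtain ⟨n, hn⟩ := exists_nat_one_div_lt hε
    obtain ⟨x, hx, η, hη, h⟩ := interior_subset (h2 (i, k, n))
    exact ⟨x, nearMax_mono P hn.le hx, η, hη, fun x' hx' => by linarith [h x' hx']⟩
  · obtain ⟨n, hn⟩ := exists_nat_one_div_lt hε
    obtain ⟨η, hη, h⟩ := interior_subset (h3 (j, n))
    exact ⟨η, hη, fun x hx x' hx' => (h x hx x' hx').trans hn.le⟩

end Generic

/-! ### Generic polynomials -/

section GenericPolynomial

variable {X W : Type*} [NormedAddCommGroup X] [NormedSpace ℂ X]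
  [NormedAddCommGroup W] [NormedSpace ℂ W]

/-- The polynomial of degree at most `n` on `X` that is given by an `n`-linear map on `X × ℂ`, by
restriction of its diagonal to the affine hyperplane `X × {1}`. -/
def affineDiag {n : ℕ} (Ψ : ContinuousMultilinearMap ℂ (fun _ : Fin n => X × ℂ) W) (x : X) : W :=
  Ψ fun _ => (x, 1)

/-- Evaluation of `affineDiag` at a point. -/
def evalAffine (W : Type*) [NormedAddCommGroup W] [NormedSpace ℂ W] (n : ℕ) (x : X) :
    ContinuousMultilinearMap ℂ (fun _ : Fin n => X × ℂ) W →L[ℂ] W :=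
  ContinuousMultilinearMap.apply ℂ (fun _ : Fin n => X × ℂ) W fun _ => (x, 1)

theorem evalAffine_apply (n : ℕ) (x : X)
    (Ψ : ContinuousMultilinearMap ℂ (fun _ : Fin n => X × ℂ) W) :
    evalAffine W n x Ψ = affineDiag Ψ x := rfl

theorem norm_evalAffine_le (n : ℕ) {x : X} {b : ℝ} (hb : 1 ≤ b) (hx : ‖x‖ ≤ b) :
    ‖evalAffine W n x‖ ≤ b ^ n := by
  refine ContinuousLinearMap.opNorm_le_bound _ (by positivity) fun Ψ => ?_
  refine (Ψ.le_opNorm _).trans ?_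
  rw [mul_comm]
  gcongr
  rw [Finset.prod_const, Finset.card_univ, Fintype.card_fin]
  gcongr
  rw [Prod.norm_def]
  simpa using ⟨hx, hb⟩

/-- The linear extension to `X × ℂ` of the affine map `x ↦ c + t x` of `X`. -/
def affineLift (c : X) (t : ℂ) : X × ℂ →L[ℂ] X × ℂ :=
  ((ContinuousLinearMap.snd ℂ X ℂ).smulRight c + t • ContinuousLinearMap.fst ℂ X ℂ).prod
    (ContinuousLinearMap.snd ℂ X ℂ)

theorem affineLift_apply (c : X) (t : ℂ) (x : X) : affineLift c t (x, 1) = (c + t • x, 1) := by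
  simp [affineLift]

theorem norm_affineLift_le {c : X} {t : ℂ} {b : ℝ} (hb : 1 ≤ b) (h : ‖c‖ + ‖t‖ ≤ b) :
    ‖affineLift c t‖ ≤ b := by
  refine ContinuousLinearMap.opNorm_le_bound _ (by linarith) fun p => ?_
  have h1 : ‖p.1‖ ≤ ‖p‖ := norm_fst_le p
  have h2 : ‖p.2‖ ≤ ‖p‖ := norm_snd_le p
  have e : affineLift c t p = (p.2 • c + t • p.1, p.2) := by simp [affineLift]
  rw [e, Prod.norm_def]
  refine max_le ?_ ?_
  · calc ‖p.2 • c + t • p.1‖ ≤ ‖p‖ * ‖c‖ + ‖t‖ * ‖p‖ := by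
          refine norm_add_le_of_le ?_ ?_ <;> rw [norm_smul] <;> gcongr
      _ = (‖c‖ + ‖t‖) * ‖p‖ := by ring
      _ ≤ b * ‖p‖ := by gcongr
  · exact h2.trans (le_mul_of_one_le_left (norm_nonneg _) hb)

/-- Affine changes of variable followed by a functional turn elements of the space of polynomials
into multipliers of it. -/
theorem isMultiplier_affine (n : ℕ) {b : ℝ} (hb : 1 ≤ b) {c : X} {t : ℂ} (h : ‖c‖ + ‖t‖ ≤ b)
    {w : StrongDual ℂ W} (hw : ‖w‖ ≤ 1)
    (Ψ : ContinuousMultilinearMap ℂ (fun _ : Fin n => X × ℂ) W) :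
    IsMultiplier (fun x : closedBall (0 : X) 1 => evalAffine W n (x : X))
      (fun x => w (affineDiag Ψ (c + t • (x : X)))) (b ^ n * ‖Ψ‖) := by
  intro y
  refine ⟨(w.smulRight y).compContinuousMultilinearMap
    (Ψ.compContinuousLinearMap fun _ => affineLift c t), fun x => ?_, ?_⟩
  · show w (Ψ fun _ => affineLift c t ((x : X), 1)) • y = _
    simp only [affineLift_apply]
    rfl
  · refine (ContinuousLinearMap.norm_compContinuousMultilinearMap_le _ _).trans ?_
    rw [ContinuousLinearMap.norm_smulRight_apply]
    have h1 : ‖Ψ.compContinuousLinearMap fun _ => affineLift c t‖ ≤ ‖Ψ‖ * b ^ n := by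
      refine (Ψ.norm_compContinuousLinearMap_le _).trans ?_
      rw [Finset.prod_const, Finset.card_univ, Fintype.card_fin]
      gcongr
      exact norm_affineLift_le hb h
    calc _ ≤ 1 * ‖y‖ * (‖Ψ‖ * b ^ n) := by gcongr
      _ = _ := by ring

/-- Affine functions are multipliers of the space of polynomials, if these may have degree one. -/
theorem exists_isMultiplier_affineFunction (n : ℕ) (ψ : StrongDual ℂ X) (c : ℂ) :
    ∃ K : ℝ, 0 ≤ K ∧
      IsMultiplier (fun x : closedBall (0 : X) 1 => evalAffine W (n + 1) (x : X))
        (fun x => 1 + c * ψ x) K := by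
  let ℓ : Fin (n + 1) → (X × ℂ →L[ℂ] ℂ) := fun i =>
    if i = 0 then ContinuousLinearMap.snd ℂ X ℂ + c • ψ ∘L ContinuousLinearMap.fst ℂ X ℂ
    else ContinuousLinearMap.snd ℂ X ℂ
  let L : ContinuousMultilinearMap ℂ (fun _ : Fin (n + 1) => X × ℂ) ℂ :=
    (ContinuousMultilinearMap.mkPiAlgebra ℂ (Fin (n + 1)) ℂ).compContinuousLinearMap ℓ
  refine ⟨‖L‖, norm_nonneg _, fun y => ⟨(ContinuousLinearMap.toSpanSingleton ℂ
    y).compContinuousMultilinearMap L, fun x => ?_, ?_⟩⟩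
  · have : L (fun _ => ((x : X), 1)) = 1 + c * ψ x := by
      simp only [L, ContinuousMultilinearMap.compContinuousLinearMap_apply,
        ContinuousMultilinearMap.mkPiAlgebra_apply]
      rw [Fin.prod_univ_succ]
      simp [ℓ, Fin.succ_ne_zero]
    show L (fun _ => ((x : X), 1)) • y = _
    rw [this]
  · refine (ContinuousLinearMap.norm_compContinuousMultilinearMap_le _ _).trans ?_
    rw [ContinuousLinearMap.norm_toSpanSingleton, mul_comm]

/-- A sequence in the dual unit ball that is norming for a separable space. -/
theorem exists_norming_sequence (W : Type*) [NormedAddCommGroup W] [NormedSpace ℂ W]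
    [TopologicalSpace.SeparableSpace W] :
    ∃ D : ℕ → StrongDual ℂ W, (∀ i, ‖D i‖ ≤ 1) ∧
      ∀ (y : W) (δ : ℝ), 0 < δ → ∃ i, ‖y‖ - δ ≤ ‖D i y‖ := by
  choose D hD hDy using fun i => exists_dual_vector'' ℂ (TopologicalSpace.denseSeq W i)
  refine ⟨D, hD, fun y δ hδ => ?_⟩
  obtain ⟨i, hi⟩ := Metric.denseRange_iff.1 (TopologicalSpace.denseRange_denseSeq W) y (δ / 2)
    (half_pos hδ)
  refine ⟨i, ?_⟩
  set u := TopologicalSpace.denseSeq W i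
  rw [dist_eq_norm] at hi
  have h1 : ‖D i (u - y)‖ ≤ ‖y - u‖ := by
    rw [norm_sub_rev y u]
    exact ((D i).le_of_opNorm_le (hD i) _).trans_eq (one_mul _)
  have h2 : ‖D i u‖ = ‖u‖ := by rw [hDy]; simp [u]
  have h3 := norm_le_norm_add_norm_sub' y u
  have h4 := norm_le_norm_add_norm_sub' (D i u) (D i y)
  rw [map_sub] at h1
  linarith

/-- The polarization-like identity that recovers a complex number `ζ` from the moduli
`|1 + i^k ζ|`. -/
theorem four_mul_eq_norm_sq (ζ : ℂ) :
    4 * ζ = ((‖1 + 1 * ζ‖ ^ 2 - ‖1 + (-1) * ζ‖ ^ 2 : ℝ) : ℂ)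
      + Complex.I * ((‖1 + (-Complex.I) * ζ‖ ^ 2 - ‖1 + Complex.I * ζ‖ ^ 2 : ℝ) : ℂ) := by
  simp only [← Complex.normSq_eq_norm_sq, Complex.normSq_apply]
  apply Complex.ext <;> simp <;> ring

/-- If the moduli of `1 + c ψ`, for `c ∈ {±1, ±i}` and `ψ` in a dense sequence of the dual, are
almost constant on the sets of a filter within the unit ball, then the filter converges
weak-star. -/
theorem exists_weakStarTendsto_of_almost_constant {F : Filter X} [F.NeBot]
    (hF : ∀ᶠ x in F, ‖x‖ ≤ 1) (ψ : ℕ → StrongDual ℂ X) (hψ : DenseRange ψ)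
    (h : ∀ (i : ℕ) (c : ℂ), c ∈ ({1, -1, -Complex.I, Complex.I} : Set ℂ) → ∀ ε : ℝ, 0 < ε →
      ∃ s ∈ F, ∀ x ∈ s, ∀ x' ∈ s, |‖1 + c * ψ i x‖ - ‖1 + c * ψ i x'‖| ≤ ε) :
    ∃ z : Bidual X, ‖z‖ ≤ 1 ∧ WeakStarTendsto F z := by
  let ev : X → WeakDual ℂ (StrongDual ℂ X) :=
    fun x => StrongDual.toWeakDual (NormedSpace.inclusionInDoubleDual ℂ X x)
  let U := Ultrafilter.of F
  have hU : (U : Filter X) ≤ F := Ultrafilter.of_le F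
  obtain ⟨β, hβ, hUβ⟩ := (WeakDual.isCompact_closedBall (𝕜 := ℂ) (0 : Bidual X)
    1).ultrafilter_le_nhds' (U.map ev) (by
      have : ∀ᶠ x in (U : Filter X), ‖x‖ ≤ 1 := hU hF
      refine Ultrafilter.mem_map.2 (this.mono fun x hx => ?_)
      show NormedSpace.inclusionInDoubleDual ℂ X x ∈ closedBall (0 : Bidual X) 1
      rw [mem_closedBall_zero_iff]
      exact (NormedSpace.double_dual_bound ℂ X x).trans hx)
  set z : Bidual X := WeakDual.toStrongDual β with hz
  have hz1 : ‖z‖ ≤ 1 := by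
    have : z ∈ closedBall (0 : Bidual X) 1 := hβ
    rwa [mem_closedBall_zero_iff] at this
  have hUz : ∀ ψ : StrongDual ℂ X, Tendsto (fun x => ψ x) U (𝓝 (z ψ)) := by
    intro ψ
    have : Tendsto (fun y : WeakDual ℂ (StrongDual ℂ X) => y ψ) (𝓝 β) (𝓝 (β ψ)) :=
      (WeakDual.eval_continuous ψ).tendsto β
    exact this.comp hUβ
  have hmod : ∀ (i : ℕ) (c : ℂ), c ∈ ({1, -1, -Complex.I, Complex.I} : Set ℂ) →
      Tendsto (fun x => ‖1 + c * ψ i x‖) F (𝓝 ‖1 + c * z (ψ i)‖) := by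
    intro i c hc
    refine Metric.tendsto_nhds.2 fun ε hε => ?_
    obtain ⟨s, hs, hsε⟩ := h i c hc (ε / 2) (half_pos hε)
    filter_upwards [hs] with x hx
    have hlim : Tendsto (fun x' => |‖1 + c * ψ i x‖ - ‖1 + c * ψ i x'‖|) U
        (𝓝 |‖1 + c * ψ i x‖ - ‖1 + c * z (ψ i)‖|) :=
      (tendsto_const_nhds.sub ((tendsto_const_nhds.add ((hUz (ψ i)).const_mul c)).norm)).abs
    have := le_of_tendsto hlim (Filter.Eventually.filter_mono hU
      (Filter.mem_of_superset hs fun x' hx' => hsε x hx x' hx'))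
    rw [Real.dist_eq]
    linarith
  have hdense : ∀ i, Tendsto (fun x => ψ i x) F (𝓝 (z (ψ i))) := by
    intro i
    have e : ∀ ζ : ℂ, ζ = (1 / 4 : ℂ) * (((‖1 + 1 * ζ‖ ^ 2 - ‖1 + (-1) * ζ‖ ^ 2 : ℝ) : ℂ)
      + Complex.I * ((‖1 + (-Complex.I) * ζ‖ ^ 2 - ‖1 + Complex.I * ζ‖ ^ 2 : ℝ) : ℂ)) := by
      intro ζ
      rw [← four_mul_eq_norm_sq]
      ring
    rw [e (z (ψ i))]
    refine Tendsto.congr (fun x => (e (ψ i x)).symm) ?_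
    have a1 := (hmod i 1 (by simp)).pow 2
    have a2 := (hmod i (-1) (by simp)).pow 2
    have a3 := (hmod i (-Complex.I) (by simp)).pow 2
    have a4 := (hmod i Complex.I (by simp)).pow 2
    exact (((Complex.continuous_ofReal.tendsto _).comp (a1.sub a2)).add
      (((Complex.continuous_ofReal.tendsto _).comp (a3.sub a4)).const_mul _)).const_mul _
  refine ⟨z, hz1, fun φ => Metric.tendsto_nhds.2 fun ε hε => ?_, hF⟩
  obtain ⟨i, hi⟩ := Metric.denseRange_iff.1 hψ φ (ε / 4) (by positivity)
  rw [dist_eq_norm] at hi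
  filter_upwards [hF, Metric.tendsto_nhds.1 (hdense i) (ε / 2) (half_pos hε)] with x hx hxi
  rw [dist_eq_norm] at hxi ⊢
  have e : φ x - z φ = (φ - ψ i) x + (ψ i x - z (ψ i)) - z (φ - ψ i) := by
    rw [map_sub, _root_.sub_apply]
    ring
  rw [e]
  have b1 : ‖(φ - ψ i) x‖ ≤ ε / 4 := by
    refine ((φ - ψ i).le_opNorm x).trans ?_
    nlinarith [norm_nonneg (φ - ψ i), norm_nonneg x]
  have b2 : ‖z (φ - ψ i)‖ < ε / 4 := by
    refine (z.le_of_opNorm_le hz1 _).trans_lt ?_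
    rwa [one_mul]
  have b3 := norm_sub_le ((φ - ψ i) x + (ψ i x - z (ψ i))) (z (φ - ψ i))
  have b4 := norm_add_le ((φ - ψ i) x) (ψ i x - z (ψ i))
  linarith

/-- Polynomials are uniformly continuous on bounded sets: a version for small translations. -/
theorem exists_affineDiag_add_sub_le {n : ℕ}
    (Ψ : ContinuousMultilinearMap ℂ (fun _ : Fin n => X × ℂ) W) (R : ℝ) {ε : ℝ} (hε : 0 < ε) :
    ∃ ρ : ℝ, 0 < ρ ∧ ∀ x y : X, ‖x‖ ≤ R → ‖y - x‖ < ρ →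
      ‖affineDiag Ψ y - affineDiag Ψ x‖ < ε := by
  set L : ℝ := ‖Ψ‖ * n * max (|R| + 1) 1 ^ (n - 1) with hL
  have hL0 : 0 ≤ L := by positivity
  refine ⟨min 1 (ε / (L + 1)), by positivity, fun x y hx hxy => ?_⟩
  have h1 : ‖y - x‖ < 1 := hxy.trans_le (min_le_left _ _)
  have h2 : ‖y - x‖ < ε / (L + 1) := hxy.trans_le (min_le_right _ _)
  have hxR : ‖x‖ ≤ |R| + 1 := by linarith [le_abs_self R]
  have hyR : ‖y‖ ≤ |R| + 1 := by
    have := norm_le_norm_add_norm_sub' y x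
    linarith [le_abs_self R]
  have hn : ∀ u : X, ‖u‖ ≤ |R| + 1 → ‖fun _ : Fin n => (u, (1 : ℂ))‖ ≤ max (|R| + 1) 1 := by
    intro u hu
    refine (pi_norm_le_iff_of_nonneg (by positivity)).2 fun _ => ?_
    rw [Prod.norm_def]
    exact max_le_max hu (by simp)
  have hd : ‖(fun _ : Fin n => (y, (1 : ℂ))) - fun _ => (x, 1)‖ ≤ ‖y - x‖ := by
    refine (pi_norm_le_iff_of_nonneg (norm_nonneg _)).2 fun _ => ?_
    rw [Pi.sub_apply, Prod.mk_sub_mk, sub_self, Prod.norm_def]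
    simp
  have := Ψ.norm_image_sub_le (fun _ => (y, (1 : ℂ))) fun _ => (x, 1)
  rw [Fintype.card_fin] at this
  calc ‖affineDiag Ψ y - affineDiag Ψ x‖
      ≤ ‖Ψ‖ * n * max ‖fun _ : Fin n => (y, (1 : ℂ))‖ ‖fun _ : Fin n => (x, (1 : ℂ))‖ ^ (n - 1)
        * ‖(fun _ : Fin n => (y, (1 : ℂ))) - fun _ => (x, 1)‖ := this
    _ ≤ L * ‖y - x‖ := by
      rw [hL]
      gcongr ‖Ψ‖ * n * ?_ ^ (n - 1) * ?_
      exact max_le (hn y hyR) (hn x hxR)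
    _ ≤ L * (ε / (L + 1)) := by gcongr
    _ < ε := by
      rw [mul_div_assoc', div_lt_iff₀ (by positivity)]
      nlinarith

/-- The behaviour of generic polynomials with values in a separable space: a filter `F` of almost
maximizers converges weak-star; some functional `w` almost attains the norm along `F`; and in
`w ∘ p` a point `x` can be replaced, partially, by further almost maximizers `x'`. -/
theorem exists_generic_polynomial [CompleteSpace W] [TopologicalSpace.SeparableSpace W]
    [Nontrivial W] [TopologicalSpace.SeparableSpace X]
    [TopologicalSpace.SeparableSpace (StrongDual ℂ X)] (n : ℕ)
    (Ψ₀ : ContinuousMultilinearMap ℂ (fun _ : Fin (n + 1) => X × ℂ) W) {δ : ℝ} (hδ : 0 < δ) :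
    ∃ Ψ : ContinuousMultilinearMap ℂ (fun _ : Fin (n + 1) => X × ℂ) W, ‖Ψ - Ψ₀‖ < δ ∧
    ∃ (F : Filter X) (z : Bidual X) (m : ℝ), F.NeBot ∧ ‖z‖ ≤ 1 ∧ WeakStarTendsto F z ∧
      (∀ x : X, ‖x‖ ≤ 1 → ‖affineDiag Ψ x‖ ≤ m) ∧
      ∀ ε : ℝ, 0 < ε → ∃ w : StrongDual ℂ W, ‖w‖ ≤ 1 ∧
        (∀ᶠ x in F, m - ε ≤ ‖w (affineDiag Ψ x)‖) ∧
        ∀ (M r : ℕ) (a : X) (κ : ℝ), 0 < κ → ∃ᶠ x in F, ∀ᶠ x' in F,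
          ‖w (affineDiag Ψ (a + ((1 - r / M : ℝ) : ℂ) • x))‖ - κ ≤
          ‖w (affineDiag Ψ (a + ((1 / M : ℝ) : ℂ) • x
            + ((1 - r / M - 1 / M : ℝ) : ℂ) • x'))‖ := by
  obtain ⟨D, hD1, hD⟩ := exists_norming_sequence W
  let A : ℕ → X := TopologicalSpace.denseSeq X
  let ψ : ℕ → StrongDual ℂ X := TopologicalSpace.denseSeq (StrongDual ℂ X)
  let ev : closedBall (0 : X) 1 → ContinuousMultilinearMap ℂ (fun _ : Fin (n + 1) => X × ℂ) W →L[ℂ]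
    W := fun x => evalAffine W (n + 1) (x : X)
  have hev : ∀ x, ‖ev x‖ ≤ 1 := fun x =>
    (norm_evalAffine_le (n + 1) le_rfl (mem_closedBall_zero_iff.1 x.2)).trans_eq (one_pow _)
  let b : ℕ × ℕ × ℕ → ℝ := fun k => ‖A k.1‖ + ‖((1 / k.2.1 : ℝ) : ℂ)‖ +
    ‖((1 - k.2.2 / k.2.1 - 1 / k.2.1 : ℝ) : ℂ)‖ + 1
  have hb1 : ∀ k, 1 ≤ b k := fun k => by
    have : 0 ≤ ‖A k.1‖ + ‖((1 / k.2.1 : ℝ) : ℂ)‖ +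
      ‖((1 - k.2.2 / k.2.1 - 1 / k.2.1 : ℝ) : ℂ)‖ := by positivity
    simp only [b]
    linarith
  have hbx : ∀ k (x : closedBall (0 : X) 1), ‖A k.1 + ((1 / k.2.1 : ℝ) : ℂ) • (x : X)‖ +
      ‖((1 - k.2.2 / k.2.1 - 1 / k.2.1 : ℝ) : ℂ)‖ ≤ b k := by
    intro k x
    have h1 : ‖((1 / k.2.1 : ℝ) : ℂ) • (x : X)‖ ≤ ‖((1 / k.2.1 : ℝ) : ℂ)‖ := by
      rw [norm_smul]
      exact mul_le_of_le_one_right (norm_nonneg _) (mem_closedBall_zero_iff.1 x.2)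
    have h2 := norm_add_le (A k.1) (((1 / k.2.1 : ℝ) : ℂ) • (x : X))
    simp only [b]
    linarith
  choose K hK hKmul using fun j : ℕ × ({1, -1, -Complex.I, Complex.I} : Finset ℂ) =>
    exists_isMultiplier_affineFunction (W := W) n (ψ j.1) (j.2 : ℂ)
  obtain ⟨Ψ, hΨ, h1, h2, h3⟩ := exists_generic (ev := ev) hev D hD1 hD
    (fun i P => by
      have := isMultiplier_affine (W := W) (X := X) (n + 1) (b := 1) le_rfl (c := 0) (t := 1)
        (by simp) (hD1 i) P
      simp only [zero_add, one_smul, one_pow, one_mul] at this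
      exact this)
    (κ := ℕ × ℕ × ℕ)
    (fun k x x' => evalAffine W (n + 1) (A k.1 + ((1 / k.2.1 : ℝ) : ℂ) • (x : X)
      + ((1 - k.2.2 / k.2.1 - 1 / k.2.1 : ℝ) : ℂ) • (x' : X)))
    (fun k => b k ^ (n + 1)) (fun k => pow_nonneg (zero_le_one.trans (hb1 k)) _)
    (fun k x x' => norm_evalAffine_le (n + 1) (hb1 k) (by
      refine (norm_add_le_of_le le_rfl ?_).trans (hbx k x)
      rw [norm_smul]
      exact mul_le_of_le_one_right (norm_nonneg _) (mem_closedBall_zero_iff.1 x'.2)))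
    (fun i k x P => isMultiplier_affine (n + 1) (hb1 k) (hbx k x) (hD1 i) P)
    (fun j x => 1 + (j.2 : ℂ) * ψ j.1 x) K hK hKmul Ψ₀ hδ
  -- the filter of almost maximizers
  let N : Filter (closedBall (0 : X) 1) := ⨅ η ∈ Set.Ioi (0 : ℝ), 𝓟 (nearMax ev Ψ η)
  have hN : N.HasBasis (fun η : ℝ => 0 < η) fun η => nearMax ev Ψ η := by
    refine hasBasis_biInf_principal (fun η hη η' hη' => ?_) ⟨1, Set.mem_Ioi.2 one_pos⟩
    exact ⟨min η η', Set.mem_Ioi.2 (lt_min (Set.mem_Ioi.1 hη) (Set.mem_Ioi.1 hη')),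
      nearMax_mono Ψ (min_le_left _ _), nearMax_mono Ψ (min_le_right _ _)⟩
  have hNe : N.NeBot := hN.neBot_iff.2 fun hη => nearMax_nonempty Ψ hη
  let F : Filter X := N.map Subtype.val
  have hFe : F.NeBot := hNe.map _
  have hFb : ∀ᶠ x in F, ‖x‖ ≤ 1 :=
    Filter.eventually_map.2 (Eventually.of_forall fun x => mem_closedBall_zero_iff.1 x.2)
  obtain ⟨z, hz, hFz⟩ := exists_weakStarTendsto_of_almost_constant hFb ψ
    (TopologicalSpace.denseRange_denseSeq _) (by
      intro i c hc ε hε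
      obtain ⟨η, hη, h⟩ := h3 (i, ⟨c, by simpa using hc⟩) ε hε
      refine ⟨Subtype.val '' nearMax ev Ψ η, image_mem_map (hN.mem_of_mem hη), ?_⟩
      rintro _ ⟨x, hx, rfl⟩ _ ⟨x', hx', rfl⟩
      exact h x hx x' hx')
  refine ⟨Ψ, hΨ, F, z, supSeminorm ev Ψ, hFe, hz, hFz, fun x hx =>
    norm_ev_le_supSeminorm hev ⟨x, mem_closedBall_zero_iff.2 hx⟩ Ψ, fun ε hε => ?_⟩
  obtain ⟨i, η, hη, hi⟩ := h1 ε hε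
  refine ⟨D i, hD1 i, Filter.eventually_map.2 (hN.mem_iff.2 ⟨η, hη, hi⟩), ?_⟩
  intro M r a κ hκ
  -- reduction to a dense sequence of centres
  obtain ⟨ρ, hρ, hΨρ⟩ := exists_affineDiag_add_sub_le Ψ
    (‖a‖ + ‖((1 / M : ℝ) : ℂ)‖ + ‖((1 - r / M - 1 / M : ℝ) : ℂ)‖) (ε := κ / 3) (by positivity)
  obtain ⟨l, hl⟩ := Metric.denseRange_iff.1 (TopologicalSpace.denseRange_denseSeq X) a ρ hρ
  rw [dist_comm, dist_eq_norm] at hl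
  have hclose : ∀ x x' : closedBall (0 : X) 1,
      ‖D i (affineDiag Ψ (A l + ((1 / M : ℝ) : ℂ) • (x : X)
          + ((1 - r / M - 1 / M : ℝ) : ℂ) • (x' : X)))
        - D i (affineDiag Ψ (a + ((1 / M : ℝ) : ℂ) • (x : X)
          + ((1 - r / M - 1 / M : ℝ) : ℂ) • (x' : X)))‖ ≤ κ / 3 := by
    intro x x'
    rw [← map_sub]
    refine ((D i).le_of_opNorm_le (hD1 i) _).trans ?_
    rw [one_mul]
    refine (hΨρ _ _ ?_ ?_).le
    · refine norm_add_le_of_le (norm_add_le_of_le le_rfl ?_) ?_ <;> rw [norm_smul]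
      · exact mul_le_of_le_one_right (norm_nonneg _) (mem_closedBall_zero_iff.1 x.2)
      · exact mul_le_of_le_one_right (norm_nonneg _) (mem_closedBall_zero_iff.1 x'.2)
    · rw [add_sub_add_right_eq_sub, add_sub_add_right_eq_sub]
      exact hl
  refine Filter.frequently_map.2 (hN.frequently_iff.2 fun {η} hη => ?_)
  obtain ⟨x, hx, η', hη', h⟩ := h2 i (l, M, r) (min η (κ / 3)) (lt_min hη (by positivity))
  refine ⟨x, nearMax_mono Ψ (min_le_left _ _) hx, Filter.eventually_map.2
    (hN.mem_iff.2 ⟨η', hη', fun x' hx' => ?_⟩)⟩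
  have e1 := h x' hx'
  simp only [evalAffine_apply] at e1
  have e2 := hclose x x'
  have e3 := hclose x x
  have e4 : a + ((1 - r / M : ℝ) : ℂ) • (x : X) = a + ((1 / M : ℝ) : ℂ) • (x : X)
      + ((1 - r / M - 1 / M : ℝ) : ℂ) • (x : X) := by
    push_cast
    module
  have e5 : min η (κ / 3) ≤ κ / 3 := min_le_right _ _
  rw [Set.mem_ofPred_eq, e4]
  have e6 := norm_le_norm_add_norm_sub' (D i (affineDiag Ψ (A l + ((1 / M : ℝ) : ℂ) • (x : X)
          + ((1 - r / M - 1 / M : ℝ) : ℂ) • (x' : X)))) (D i (affineDiag Ψ (a + ((1 / M : ℝ) : ℂ)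
          • (x : X) + ((1 - r / M - 1 / M : ℝ) : ℂ) • (x' : X))))
  have e7 := norm_le_norm_add_norm_sub (D i (affineDiag Ψ (A l + ((1 / M : ℝ) : ℂ) • (x : X)
          + ((1 - r / M - 1 / M : ℝ) : ℂ) • (x : X)))) (D i (affineDiag Ψ (a + ((1 / M : ℝ) : ℂ)
          • (x : X) + ((1 - r / M - 1 / M : ℝ) : ℂ) • (x : X))))
  linarith

end GenericPolynomial

/-! ### Polynomials whose Aron–Berner extension attains its norm -/

section Polynomial

variable {X W : Type*} [NormedAddCommGroup X] [NormedSpace ℂ X]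
  [NormedAddCommGroup W] [NormedSpace ℂ W]

/-- The version of `exists_generic_polynomial` for values in an arbitrary Banach space: a
polynomial on a separable space has values in a separable subspace. -/
theorem exists_generic_polynomial_of_separable_domain [CompleteSpace W]
    [TopologicalSpace.SeparableSpace X]
    [TopologicalSpace.SeparableSpace (StrongDual ℂ X)] (n : ℕ)
    (Ψ₀ : ContinuousMultilinearMap ℂ (fun _ : Fin (n + 1) => X × ℂ) W) {δ : ℝ} (hδ : 0 < δ) :
    ∃ Ψ : ContinuousMultilinearMap ℂ (fun _ : Fin (n + 1) => X × ℂ) W, ‖Ψ - Ψ₀‖ < δ ∧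
    ∃ (F : Filter X) (z : Bidual X) (m : ℝ), F.NeBot ∧ ‖z‖ ≤ 1 ∧ WeakStarTendsto F z ∧
      (∀ x : X, ‖x‖ ≤ 1 → ‖affineDiag Ψ x‖ ≤ m) ∧
      ∀ ε : ℝ, 0 < ε → ∃ w : StrongDual ℂ W, ‖w‖ ≤ 1 ∧
        (∀ᶠ x in F, m - ε ≤ ‖w (affineDiag Ψ x)‖) ∧
        ∀ (M r : ℕ) (a : X) (κ : ℝ), 0 < κ → ∃ᶠ x in F, ∀ᶠ x' in F,
          ‖w (affineDiag Ψ (a + ((1 - r / M : ℝ) : ℂ) • x))‖ - κ ≤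
          ‖w (affineDiag Ψ (a + ((1 / M : ℝ) : ℂ) • x
            + ((1 - r / M - 1 / M : ℝ) : ℂ) • x'))‖ := by
  let V : Submodule ℂ W := (Submodule.span ℂ (Set.range Ψ₀)).topologicalClosure
  have hVs : TopologicalSpace.SeparableSpace V := by
    have h1 : TopologicalSpace.IsSeparable (Set.range Ψ₀) :=
      TopologicalSpace.isSeparable_range Ψ₀.cont
    have h2 : TopologicalSpace.IsSeparable (V : Set W) := by
      rw [Submodule.topologicalClosure_coe]
      exact (h1.span (R := ℂ)).closure
    exact h2.separableSpace
  have hVc : CompleteSpace V := (Submodule.isClosed_topologicalClosure _).completeSpace_coe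
  have hV : ∀ v, Ψ₀ v ∈ V := fun v =>
    Submodule.le_topologicalClosure _ (Submodule.subset_span ⟨v, rfl⟩)
  rcases subsingleton_or_nontrivial V with hsub | hnt
  · have h0 : ∀ x : X, affineDiag Ψ₀ x = 0 := fun x =>
      congrArg Subtype.val (Subsingleton.elim (⟨_, hV _⟩ : V) 0)
    refine ⟨Ψ₀, by simpa using hδ, pure 0, 0, 0, inferInstance, by simp, ⟨fun ψ => ?_, ?_⟩,
      fun x _ => by simp [h0], fun ε hε => ⟨0, by simp, by simp [hε.le], ?_⟩⟩
    · simpa using tendsto_pure_nhds ψ (0 : X)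
    · simp
    · intro M r a κ hκ
      simp [hκ.le]
  · let Ψ₁ : ContinuousMultilinearMap ℂ (fun _ : Fin (n + 1) => X × ℂ) V := Ψ₀.codRestrict V hV
    obtain ⟨Ψ, hΨ, F, z, m, hF, hz, hFz, hm, h⟩ := exists_generic_polynomial n Ψ₁ hδ
    have hval : ∀ x, affineDiag (V.subtypeL.compContinuousMultilinearMap Ψ) x
        = (affineDiag Ψ x : V) := fun x => rfl
    refine ⟨V.subtypeL.compContinuousMultilinearMap Ψ, ?_, F, z, m, hF, hz, hFz, hm, ?_⟩
    · refine lt_of_le_of_lt (ContinuousMultilinearMap.opNorm_le_bound (norm_nonneg (Ψ - Ψ₁))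
        fun v => ?_) hΨ
      exact (Ψ - Ψ₁).le_opNorm v
    · intro ε hε
      obtain ⟨w, hw, hw1, hw2⟩ := h ε hε
      obtain ⟨w', hw', hn⟩ := exists_extension_norm_eq V w
      refine ⟨w', hn.trans_le hw, ?_, ?_⟩
      · simpa only [hval, hw'] using hw1
      · simpa only [hval, hw'] using hw2

/-- The restriction to an affine hyperplane of the diagonal of a multilinear map is a
polynomial. -/
theorem exists_affineDiag_eq_formSum {n : ℕ}
    (Ψ : ContinuousMultilinearMap ℂ (fun _ : Fin n => X × ℂ) W) :
    ∃ Φ : ∀ j : ℕ, ContinuousMultilinearMap ℂ (fun _ : Fin j => X) W,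
      ∀ x, affineDiag Ψ x = formSum n Φ x := by
  let q : FormalMultilinearSeries ℂ (X × ℂ) W := fun j =>
    if h : n = j then h ▸ Ψ else 0
  have hq : ∀ m, n + 1 ≤ m → q m = 0 := fun m hm => dif_neg (by omega)
  have hsum : ∀ v, q.sum v = Ψ fun _ => v := by
    intro v
    rw [FormalMultilinearSeries.sum, tsum_eq_single n]
    · simp [q]
    · intro m hm
      simp [q, hm.symm]
  refine ⟨fun j => (q.changeOrigin (0, 1) j).compContinuousLinearMap
    fun _ => ContinuousLinearMap.inl ℂ X ℂ, fun x => ?_⟩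
  have h := q.changeOrigin_eval_of_finite hq (0, 1) (x, 0)
  rw [hsum, Prod.mk_add_mk, zero_add, add_zero] at h
  rw [affineDiag, ← h, FormalMultilinearSeries.sum, formSum, tsum_eq_sum (s := Finset.range (n + 1))]
  · rfl
  · intro j hj
    rw [Finset.mem_range, not_lt] at hj
    rw [q.changeOrigin_finite_of_finite hq hj]
    rfl

theorem analyticOnNhd_formSum (N : ℕ)
    (Φ : ∀ j : ℕ, ContinuousMultilinearMap ℂ (fun _ : Fin j => X) W) (s : Set X) :
    AnalyticOnNhd ℂ (formSum N Φ) s := by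
  refine Finset.analyticOnNhd_fun_sum _ fun j _ x _ => ?_
  have h : AnalyticAt ℂ (fun x : X => fun _ : Fin j => x) x :=
    (ContinuousLinearMap.pi fun _ : Fin j => ContinuousLinearMap.id ℂ X).analyticAt x
  exact ((Φ j).analyticAt).comp h

/-- Polynomials are Lipschitz on the unit ball. -/
theorem exists_formSum_sub_le (N : ℕ)
    (Φ : ∀ j : ℕ, ContinuousMultilinearMap ℂ (fun _ : Fin j => X) W) :
    ∃ L : ℝ, 0 ≤ L ∧ ∀ x y : X, ‖x‖ ≤ 1 → ‖y‖ ≤ 1 →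
      ‖formSum N Φ x - formSum N Φ y‖ ≤ L * ‖x - y‖ := by
  refine ⟨∑ j ∈ Finset.range (N + 1), ‖Φ j‖ * j, by positivity, fun x y hx hy => ?_⟩
  rw [formSum, formSum, ← Finset.sum_sub_distrib, Finset.sum_mul]
  refine norm_sum_le_of_le _ fun j _ => ?_
  have hn : ∀ u : X, ‖u‖ ≤ 1 → ‖fun _ : Fin j => u‖ ≤ 1 := fun u hu =>
    (pi_norm_le_iff_of_nonneg zero_le_one).2 fun _ => hu
  have hd : ‖(fun _ : Fin j => x) - fun _ => y‖ ≤ ‖x - y‖ :=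
    (pi_norm_le_iff_of_nonneg (norm_nonneg _)).2 fun _ => le_rfl
  have := (Φ j).norm_image_sub_le (fun _ => x) fun _ => y
  rw [Fintype.card_fin] at this
  refine this.trans ?_
  calc ‖Φ j‖ * j * max ‖fun _ : Fin j => x‖ ‖fun _ : Fin j => y‖ ^ (j - 1)
        * ‖(fun _ : Fin j => x) - fun _ => y‖ ≤ ‖Φ j‖ * j * 1 ^ (j - 1) * ‖x - y‖ := by
        gcongr ‖Φ j‖ * j * ?_ ^ (j - 1) * ?_
        exact max_le (hn x hx) (hn y hy)
    _ = _ := by rw [one_pow, mul_one]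

/-- The polynomial `formSum N Φ` as an element of `Au X W`. -/
theorem exists_Au_eq_formSum (N : ℕ)
    (Φ : ∀ j : ℕ, ContinuousMultilinearMap ℂ (fun _ : Fin j => X) W) :
    ∃ f : Au X W, ∀ x : closedBall (0 : X) 1,
      (f : closedBall (0 : X) 1 →ᵇ W) x = formSum N Φ x := by
  obtain ⟨L, hL, h⟩ := exists_formSum_sub_le N Φ
  have hlip : LipschitzWith ⟨L, hL⟩ fun x : closedBall (0 : X) 1 => formSum N Φ x := by
    refine LipschitzWith.of_dist_le_mul fun x y => ?_
    rw [dist_eq_norm, Subtype.dist_eq, dist_eq_norm]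
    exact h x y (mem_closedBall_zero_iff.1 x.2) (mem_closedBall_zero_iff.1 y.2)
  let f : closedBall (0 : X) 1 →ᵇ W := BoundedContinuousFunction.mkOfBound
    ⟨fun x => formSum N Φ x, hlip.continuous⟩ (L * 2) fun x y => by
      refine (hlip.dist_le_mul x y).trans ?_
      refine mul_le_mul_of_nonneg_left ?_ hL
      rw [Subtype.dist_eq, dist_eq_norm]
      exact (norm_sub_le_of_le (mem_closedBall_zero_iff.1 x.2)
        (mem_closedBall_zero_iff.1 y.2)).trans_eq one_add_one_eq_two
  refine ⟨⟨f, hlip.uniformContinuous, ?_⟩, fun x => rfl⟩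
  refine (analyticOnNhd_formSum N Φ (ball 0 1)).congr isOpen_ball fun x hx => ?_
  rw [ballExtend, dif_pos (ball_subset_closedBall hx)]
  rfl

/-- The Taylor coefficients of a polynomial are the symmetrizations of its given coefficients. -/
theorem taylorMultilinear_apply_of_eq_formSum [CompleteSpace W] {f : Au X W} {N : ℕ}
    {Φ : ∀ j : ℕ, ContinuousMultilinearMap ℂ (fun _ : Fin j => X) W}
    (hf : ∀ x : closedBall (0 : X) 1, (f : closedBall (0 : X) 1 →ᵇ W) x = formSum N Φ x)
    (j : ℕ) (v : Fin j → X) :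
    taylorMultilinear f j v = if j ≤ N then
      ((j.factorial : ℂ)⁻¹) • ∑ σ : Equiv.Perm (Fin j), Φ j fun i => v (σ i) else 0 := by
  let q : FormalMultilinearSeries ℂ X W := fun j => if j ≤ N then Φ j else 0
  have hq : ∀ m, N + 1 ≤ m → q m = 0 := fun m hm => if_neg (by omega)
  have hs : HasFPowerSeriesOnBall q.sum q 0 ⊤ :=
    (q.hasFiniteFPowerSeriesOnBall_of_finite hq).toHasFPowerSeriesOnBall
  have hsum : q.sum = formSum N Φ := by
    ext x
    rw [FormalMultilinearSeries.sum, formSum, tsum_eq_sum (s := Finset.range (N + 1))]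
    · refine Finset.sum_congr rfl fun j hj => ?_
      have : j ≤ N := by
        rw [Finset.mem_range] at hj
        omega
      simp [q, this]
    · intro j hj
      rw [Finset.mem_range, not_lt] at hj
      rw [hq j hj]
      rfl
  have hev : ballExtend (f : closedBall (0 : X) 1 →ᵇ W) =ᶠ[𝓝 0] q.sum := by
    filter_upwards [ball_mem_nhds (0 : X) one_pos] with x hx
    rw [ballExtend, dif_pos (ball_subset_closedBall hx), hf, hsum]
  rw [taylorMultilinear, _root_.smul_apply, (Filter.EventuallyEq.iteratedFDeriv ℂ hev j).eq_of_nhds,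
    hs.iteratedFDeriv_eq_sum_of_completeSpace]
  split_ifs with h
  · simp [q, h]
  · simp [q, h]

theorem isSymmForm_taylorMultilinear [CompleteSpace W] {f : Au X W} {N : ℕ}
    {Φ : ∀ j : ℕ, ContinuousMultilinearMap ℂ (fun _ : Fin j => X) W}
    (hf : ∀ x : closedBall (0 : X) 1, (f : closedBall (0 : X) 1 →ᵇ W) x = formSum N Φ x) (j : ℕ) :
    IsSymmForm (taylorMultilinear f j) := by
  intro τ v
  rw [taylorMultilinear_apply_of_eq_formSum hf, taylorMultilinear_apply_of_eq_formSum hf]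
  congr 2
  exact Fintype.sum_equiv (Equiv.mulLeft τ) _ _ fun σ => rfl

theorem formSum_taylorMultilinear [CompleteSpace W] {f : Au X W} {N : ℕ}
    {Φ : ∀ j : ℕ, ContinuousMultilinearMap ℂ (fun _ : Fin j => X) W}
    (hf : ∀ x : closedBall (0 : X) 1, (f : closedBall (0 : X) 1 →ᵇ W) x = formSum N Φ x) (x : X) :
    formSum N (taylorMultilinear f) x = formSum N Φ x := by
  refine Finset.sum_congr rfl fun j hj => ?_
  rw [taylorMultilinear_apply_of_eq_formSum hf, if_pos (by rw [Finset.mem_range] at hj; omega),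
    Finset.sum_const, Finset.card_univ, Fintype.card_perm, Fintype.card_fin,
    ← Nat.cast_smul_eq_nsmul ℂ, smul_smul, inv_mul_cancel₀ (by exact_mod_cast j.factorial_ne_zero),
    one_smul]

/-- The Aron–Berner extension of a polynomial attains its norm at `z` if its values there are
almost as large as the supremum of the polynomial on the unit ball. -/
theorem aronBernerAttainsNorm_of_formSum [CompleteSpace W] {f : Au X W} {N : ℕ}
    {Φ : ∀ j : ℕ, ContinuousMultilinearMap ℂ (fun _ : Fin j => X) W}
    (hf : ∀ x : closedBall (0 : X) 1, (f : closedBall (0 : X) 1 →ᵇ W) x = formSum N Φ x)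
    {m : ℝ} (hm : ∀ x : X, ‖x‖ ≤ 1 → ‖formSum N Φ x‖ ≤ m) {z : Bidual X} (hz : ‖z‖ ≤ 1)
    (h : ∀ ε : ℝ, 0 < ε → ∃ w : StrongDual ℂ W, ‖w‖ ≤ 1 ∧ m - ε ≤
      ‖arensSum N (fun j => w.compContinuousMultilinearMap (taylorMultilinear f j)) z‖) :
    AronBernerAttainsNorm f := by
  obtain ⟨F, hF⟩ := exists_Au_eq_formSum N fun j => arensMultilinear (taylorMultilinear f j)
  have hFw : ∀ (b : closedBall (0 : Bidual X) 1) (w : StrongDual ℂ W),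
      (F : closedBall (0 : Bidual X) 1 →ᵇ Bidual W) b w
        = arensSum N (fun j => w.compContinuousMultilinearMap (taylorMultilinear f j)) b := by
    intro b w
    rw [hF]
    simp only [formSum, arensSum, _root_.sum_apply]
    rfl
  have hm0 : 0 ≤ m := (norm_nonneg _).trans (hm 0 (by simp))
  have hup : ∀ b, ‖(F : closedBall (0 : Bidual X) 1 →ᵇ Bidual W) b‖ ≤ m := by
    intro b
    refine ContinuousLinearMap.opNorm_le_bound _ hm0 fun w => ?_
    rw [hFw]
    refine norm_arensSum_le N _ (fun j σ v => ?_) (fun x hx => ?_)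
      (mem_closedBall_zero_iff.1 b.2)
    · exact congrArg w (isSymmForm_taylorMultilinear hf j σ v)
    · have : formSum N (fun j => w.compContinuousMultilinearMap (taylorMultilinear f j)) x
          = w (formSum N Φ x) := by
        rw [← formSum_taylorMultilinear hf, formSum, formSum, map_sum]
        rfl
      rw [this]
      refine (w.le_opNorm _).trans ?_
      rw [mul_comm]
      gcongr
      exact hm x hx
  have hlow : m ≤ ‖(F : closedBall (0 : Bidual X) 1 →ᵇ Bidual W)
      ⟨z, mem_closedBall_zero_iff.2 hz⟩‖ := by
    refine le_of_forall_pos_le_add fun ε hε => ?_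
    obtain ⟨w, hw, hwz⟩ := h ε hε
    have h1 := hFw ⟨z, mem_closedBall_zero_iff.2 hz⟩ w
    have h2 := ((F : closedBall (0 : Bidual X) 1 →ᵇ Bidual W)
      ⟨z, mem_closedBall_zero_iff.2 hz⟩).le_opNorm w
    rw [h1] at h2
    have h3 : ‖(F : closedBall (0 : Bidual X) 1 →ᵇ Bidual W)
      ⟨z, mem_closedBall_zero_iff.2 hz⟩‖ * ‖w‖ ≤ ‖(F : closedBall (0 : Bidual X) 1 →ᵇ Bidual W)
      ⟨z, mem_closedBall_zero_iff.2 hz⟩‖ := mul_le_of_le_one_right (norm_nonneg _) hw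
    linarith
  refine ⟨F, fun b _ => ?_, ⟨z, mem_closedBall_zero_iff.2 hz⟩, le_antisymm ?_ ?_⟩
  · rw [hF, formSum]
    refine hasSum_sum_of_ne_finset_zero fun j hj => ?_
    have h0 : taylorMultilinear f j = 0 := by
      ext v
      rw [taylorMultilinear_apply_of_eq_formSum hf, if_neg (by
        rw [Finset.mem_range] at hj
        omega)]
      rfl
    rw [h0]
    ext w
    rw [arensExtension_apply]
    have : w.compContinuousMultilinearMap
        (0 : ContinuousMultilinearMap ℂ (fun _ : Fin j => X) W) = 0 := by
      ext v
      simp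
    rw [this, map_zero]
    rfl
  · exact BoundedContinuousFunction.norm_coe_le_norm (F : closedBall (0 : Bidual X) 1 →ᵇ Bidual W) _
  · exact ((BoundedContinuousFunction.norm_le hm0).2 hup).trans hlow

/-- Every polynomial can be approximated by polynomials whose Aron–Berner extension attains its
norm. -/
theorem exists_aronBernerAttainsNorm_near [CompleteSpace W] [TopologicalSpace.SeparableSpace X]
    [TopologicalSpace.SeparableSpace (StrongDual ℂ X)] (n : ℕ)
    (Ψ₀ : ContinuousMultilinearMap ℂ (fun _ : Fin (n + 1) => X × ℂ) W) {δ : ℝ} (hδ : 0 < δ) :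
    ∃ P : Au X W, IsPolynomial P ∧ AronBernerAttainsNorm P ∧ ∀ x : closedBall (0 : X) 1,
      ‖(P : closedBall (0 : X) 1 →ᵇ W) x - affineDiag Ψ₀ x‖ ≤ δ := by
  obtain ⟨Ψ, hΨ, F, z, m, hFe, hz, hFz, hm, h⟩ :=
    exists_generic_polynomial_of_separable_domain n Ψ₀ hδ
  obtain ⟨Φ, hΦ⟩ := exists_affineDiag_eq_formSum Ψ
  obtain ⟨P, hP⟩ := exists_Au_eq_formSum (n + 1) Φ
  refine ⟨P, ⟨n + 1, Φ, hP⟩, ?_, fun x => ?_⟩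
  · refine aronBernerAttainsNorm_of_formSum hP (fun x hx => by rw [← hΦ]; exact hm x hx) hz
      fun ε hε => ?_
    obtain ⟨w, hw, hw1, hw2⟩ := h (ε / 3) (by positivity)
    refine ⟨w, hw, ?_⟩
    set φ : ∀ j : ℕ, ContinuousMultilinearMap ℂ (fun _ : Fin j => X) ℂ :=
      fun j => w.compContinuousMultilinearMap (taylorMultilinear P j) with hφ
    have hφs : ∀ j, IsSymmForm (φ j) := fun j σ v =>
      congrArg w (isSymmForm_taylorMultilinear hP j σ v)
    have hφw : ∀ x, formSum (n + 1) φ x = w (affineDiag Ψ x) := by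
      intro x
      rw [hΦ, ← formSum_taylorMultilinear hP, formSum, formSum, map_sum]
      rfl
    obtain ⟨C, hC, hav⟩ := exists_average_near_arensSum (n + 1) φ hφs
    obtain ⟨M, hM⟩ := exists_nat_gt (C / (ε / 3))
    have hM0 : (0 : ℝ) < M := lt_of_le_of_lt (by positivity) hM
    have hCM : C / M < ε / 3 := by
      rw [div_lt_iff₀ (by positivity)] at hM
      rw [div_lt_iff₀ hM0]
      linarith
    -- each of the `M` replacements may cost `ε / (3 M)`
    obtain ⟨a, ha, hQ, hd⟩ := hav F z hz hFz M (by exact_mod_cast hM0)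
      (fun r a => ∀ᶠ x in F, m - ε / 3 - r * (ε / (3 * M)) ≤
        ‖w (affineDiag Ψ (a + ((1 - r / M : ℝ) : ℂ) • x))‖)
      (by simpa using hw1)
      (fun r hr a _ hQ => by
        refine ((hw2 M r a (ε / (3 * M)) (by positivity)).and_eventually hQ).mono ?_
        rintro x ⟨hx1, hx2⟩
        filter_upwards [hx1] with x' hx'
        have e : ((1 - (r + 1 : ℕ) / M : ℝ) : ℂ) = ((1 - r / M - 1 / M : ℝ) : ℂ) := by
          push_cast
          ring
        rw [e]
        push_cast at hx' hx2 ⊢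
        linarith)
    obtain ⟨x, hx⟩ := hQ.exists
    rw [div_self hM0.ne', sub_self, Complex.ofReal_zero, zero_smul, add_zero, ← hφw] at hx
    have e : (M : ℝ) * (ε / (3 * M)) = ε / 3 := by field_simp
    rw [e] at hx
    have := norm_le_norm_add_norm_sub' (formSum (n + 1) φ a) (arensSum (n + 1) φ z)
    linarith
  · rw [hP, ← hΦ]
    have : affineDiag Ψ (x : X) - affineDiag Ψ₀ x = evalAffine W (n + 1) (x : X) (Ψ - Ψ₀) := by
      rw [map_sub]
      rfl
    rw [this]
    refine ((evalAffine W (n + 1) (x : X)).le_of_opNorm_le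
      (norm_evalAffine_le (n + 1) le_rfl (mem_closedBall_zero_iff.1 x.2)) _).trans ?_
    rw [one_pow, one_mul]
    exact hΨ.le

end Polynomial

/-! ### Approximation by polynomials -/

section Approximation

variable {X W : Type*} [NormedAddCommGroup X] [NormedSpace ℂ X]
  [NormedAddCommGroup W] [NormedSpace ℂ W]

/-- A polynomial is the restriction to an affine hyperplane of the diagonal of a multilinear
map. -/
theorem exists_formSum_eq_affineDiag (N : ℕ)
    (Φ : ∀ j : ℕ, ContinuousMultilinearMap ℂ (fun _ : Fin j => X) W) :
    ∃ Ψ : ContinuousMultilinearMap ℂ (fun _ : Fin N => X × ℂ) W,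
      ∀ x, formSum N Φ x = affineDiag Ψ x := by
  induction N with
  | zero =>
    refine ⟨ContinuousMultilinearMap.constOfIsEmpty ℂ _ (Φ 0 0), fun x => ?_⟩
    rw [formSum, affineDiag, Finset.sum_range_one, ContinuousMultilinearMap.constOfIsEmpty_apply]
    exact congrArg (Φ 0) (Subsingleton.elim _ _)
  | succ N ih =>
    obtain ⟨Ψ, hΨ⟩ := ih
    refine ⟨((ContinuousLinearMap.snd ℂ X ℂ).smulRight Ψ).uncurryLeft +
      (Φ (N + 1)).compContinuousLinearMap fun _ => ContinuousLinearMap.fst ℂ X ℂ, fun x => ?_⟩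
    have h : affineDiag ((ContinuousLinearMap.snd ℂ X ℂ).smulRight Ψ).uncurryLeft x
        = affineDiag Ψ x := one_smul ℂ _
    rw [affineDiag, _root_.add_apply]
    rw [affineDiag] at h
    rw [h, ← hΨ, formSum, Finset.sum_range_succ]
    rfl

/-- A normed space with a separable dual is separable. -/
theorem separableSpace_of_separableSpace_dual
    [TopologicalSpace.SeparableSpace (StrongDual ℂ X)] : TopologicalSpace.SeparableSpace X := by
  let ψ : ℕ → StrongDual ℂ X := TopologicalSpace.denseSeq (StrongDual ℂ X)
  -- the span of points at which the `ψ i` are at least half as large as their norms is dense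
  have hx : ∀ i, ∃ x : X, ‖x‖ ≤ 1 ∧ ‖ψ i‖ / 2 ≤ ‖ψ i x‖ := by
    intro i
    rcases eq_or_ne (ψ i) 0 with h | h
    · exact ⟨0, by simp [h]⟩
    · obtain ⟨x, hx, h'⟩ := (ψ i).exists_lt_apply_of_lt_opNorm (half_lt_self (norm_pos_iff.2 h))
      exact ⟨x, hx.le, h'.le⟩
  choose x hx1 hx2 using hx
  let V : Submodule ℂ X := (Submodule.span ℂ (Set.range x)).topologicalClosure
  have hxV : ∀ i, x i ∈ V := fun i =>
    Submodule.le_topologicalClosure _ (Submodule.subset_span ⟨i, rfl⟩)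
  have hVs : TopologicalSpace.IsSeparable (V : Set X) := by
    rw [Submodule.topologicalClosure_coe]
    exact ((Set.countable_range x).isSeparable.span (R := ℂ)).closure
  have hVc : IsClosed (V : Set X) := Submodule.isClosed_topologicalClosure _
  suffices h : V = ⊤ by
    rw [h] at hVs
    exact TopologicalSpace.isSeparable_univ_iff.1 hVs
  by_contra hne
  obtain ⟨y, hy⟩ : ∃ y, y ∉ V := by
    by_contra! hall
    exact hne (Submodule.eq_top_iff'.2 hall)
  obtain ⟨φ, hφ⟩ := SeparatingDual.exists_ne_zero (R := ℂ) (x := V.mkQL y)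
    (mt (Submodule.Quotient.mk_eq_zero V).1 hy)
  set f : StrongDual ℂ X := φ ∘L V.mkQL with hf
  have hf0 : 0 < ‖f‖ := norm_pos_iff.2 fun h => hφ (congrArg (fun g : StrongDual ℂ X => g y) h)
  have hfV : ∀ i, f (x i) = 0 := fun i => by
    have : V.mkQL (x i) = 0 := (Submodule.Quotient.mk_eq_zero V).2 (hxV i)
    rw [hf, ContinuousLinearMap.comp_apply, this, map_zero]
  obtain ⟨i, hi⟩ := Metric.denseRange_iff.1
    (TopologicalSpace.denseRange_denseSeq (StrongDual ℂ X)) f (‖f‖ / 4) (by positivity)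
  rw [dist_eq_norm] at hi
  have h1 : ‖ψ i (x i)‖ ≤ ‖f - ψ i‖ := by
    have h := (f - ψ i).unit_le_opNorm (x i) (hx1 i)
    rwa [_root_.sub_apply, hfV, zero_sub, norm_neg] at h
  have h2 := norm_le_norm_add_norm_sub' f (ψ i)
  have h3 := hx2 i
  change ‖f - ψ i‖ < _ at hi
  linarith

/-- The Cauchy estimates, in the form of a bound for the remainder of the Taylor series. -/
theorem norm_sub_taylor_le [CompleteSpace W] {h : ℂ → W} {C r R : ℝ} (hr : 0 < r) (hrR : r < R)
    (hR : R < 1) (hd : DifferentiableOn ℂ h (ball 0 1)) (hC : ∀ ζ ∈ ball (0 : ℂ) 1, ‖h ζ‖ ≤ C)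
    (N : ℕ) :
    ‖h r - ∑ j ∈ Finset.range N, (j.factorial : ℂ)⁻¹ • (r : ℂ) ^ j • iteratedDeriv j h 0‖
      ≤ C * (r / R) ^ N / (1 - r / R) := by
  have hR0 : 0 < R := hr.trans hrR
  have hs := Complex.hasSum_taylorSeries_on_ball hd (z := r)
    (by simpa [abs_of_pos hr] using hrR.trans hR)
  simp only [sub_zero] at hs
  rw [← dist_eq_norm, dist_comm]
  refine dist_le_of_le_geometric_of_tendsto (r / R) C ((div_lt_one hR0).2 hrR) (fun n => ?_)
    hs.tendsto_sum_nat N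
  have hsub : closedBall (0 : ℂ) R ⊆ ball 0 1 := closedBall_subset_ball hR
  have hdc : DiffContOnCl ℂ h (ball 0 R) := by
    refine DifferentiableOn.diffContOnCl (hd.mono ?_)
    rwa [closure_ball _ hR0.ne']
  have hb := Complex.norm_iteratedDeriv_le_of_forall_mem_sphere_norm_le n hR0 hdc
    fun ζ hζ => hC ζ (hsub (sphere_subset_closedBall hζ))
  rw [dist_comm, dist_eq_norm, Finset.sum_range_succ, add_sub_cancel_left, norm_smul, norm_smul,
    norm_inv, norm_pow, Complex.norm_natCast, Complex.norm_real, Real.norm_of_nonneg hr.le]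
  have hn : (0 : ℝ) < n.factorial := by exact_mod_cast n.factorial_pos
  calc (n.factorial : ℝ)⁻¹ * (r ^ n * ‖iteratedDeriv n h 0‖)
      ≤ (n.factorial : ℝ)⁻¹ * (r ^ n * (n.factorial * C / R ^ n)) := by gcongr
    _ = C * (r / R) ^ n := by
      rw [div_pow]
      field_simp

/-- Polynomials are dense in `Au X W`: dilations `x ↦ g (r x)` with `r < 1` approximate `g`, and
their Taylor series at `0` converges uniformly on the unit ball, by the Cauchy estimates. -/
theorem exists_formSum_near [CompleteSpace W] (g : Au X W) {ε : ℝ} (hε : 0 < ε) :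
    ∃ (N : ℕ) (Φ : ∀ j : ℕ, ContinuousMultilinearMap ℂ (fun _ : Fin j => X) W),
      ∀ x : closedBall (0 : X) 1,
        ‖(g : closedBall (0 : X) 1 →ᵇ W) x - formSum N Φ x‖ < ε := by
  set G := ballExtend (g : closedBall (0 : X) 1 →ᵇ W) with hG
  have hGa : AnalyticOnNhd ℂ G (ball 0 1) := g.2.2
  obtain ⟨q, hq⟩ := hGa 0 (mem_ball_self one_pos)
  obtain ⟨δ, hδ, hu⟩ := Metric.uniformContinuous_iff.1 g.2.1 (ε / 2) (half_pos hε)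
  obtain ⟨r, hr1, hr2⟩ := exists_between (max_lt zero_lt_one (sub_lt_self (1 : ℝ) hδ))
  obtain ⟨hr0, hrδ⟩ := max_lt_iff.1 hr1
  obtain ⟨R, hrR, hR⟩ := exists_between hr2
  set C := ‖(g : closedBall (0 : X) 1 →ᵇ W)‖ with hC
  have hrRlt : r / R < 1 := (div_lt_one (hr0.trans hrR)).2 hrR
  have hlim : Tendsto (fun N : ℕ => C * (r / R) ^ (N + 1) / (1 - r / R)) atTop (𝓝 0) := by
    have := (((tendsto_pow_atTop_nhds_zero_of_lt_one (by have := hr0.trans hrR; positivity)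
      hrRlt).comp (tendsto_add_atTop_nat 1)).const_mul C).div_const (1 - r / R)
    simpa using this
  obtain ⟨N, hN⟩ := (hlim.eventually (gt_mem_nhds (half_pos hε))).exists
  refine ⟨N, fun j => ((r : ℂ) ^ j) • q j, fun x => ?_⟩
  have hx : ‖(x : X)‖ ≤ 1 := mem_closedBall_zero_iff.1 x.2
  let u : ℂ →L[ℂ] X := ContinuousLinearMap.toSpanSingleton ℂ (x : X)
  have hu0 : u 0 = 0 := map_zero u
  have hmem : ∀ ζ ∈ ball (0 : ℂ) 1, u ζ ∈ ball (0 : X) 1 := by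
    intro ζ hζ
    rw [mem_ball_zero_iff] at hζ ⊢
    rw [ContinuousLinearMap.toSpanSingleton_apply, norm_smul]
    exact (mul_le_of_le_one_right (norm_nonneg ζ) hx).trans_lt hζ
  have hGval : ∀ (y : X) (hy : y ∈ closedBall (0 : X) 1),
      G y = (g : closedBall (0 : X) 1 →ᵇ W) ⟨y, hy⟩ := fun y hy => dif_pos hy
  have hd : DifferentiableOn ℂ (G ∘ u) (ball 0 1) := fun ζ hζ =>
    ((hGa (u ζ) (hmem ζ hζ)).differentiableAt.comp ζ u.differentiableAt).differentiableWithinAt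
  have hbd : ∀ ζ ∈ ball (0 : ℂ) 1, ‖(G ∘ u) ζ‖ ≤ C := by
    intro ζ hζ
    rw [Function.comp_apply, hGval _ (ball_subset_closedBall (hmem ζ hζ))]
    exact (g : closedBall (0 : X) 1 →ᵇ W).norm_coe_le_norm _
  -- the Taylor coefficients of the slice `ζ ↦ G (ζ x)` are the values at `x` of those of `G`
  have hcoef : ∀ j : ℕ, (j.factorial : ℂ)⁻¹ • iteratedDeriv j (G ∘ u) 0 = q j fun _ => (x : X) := by
    intro j
    rw [← hu0] at hq
    obtain ⟨ρ, hρ⟩ := hq.compContinuousLinearMap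
    have := hρ.factorial_smul (1 : ℂ) j
    rw [iteratedDeriv_eq_iteratedFDeriv, ← this, ← Nat.cast_smul_eq_nsmul ℂ, smul_smul,
      inv_mul_cancel₀ (by exact_mod_cast j.factorial_ne_zero), one_smul]
    change q j (fun _ => u 1) = _
    simp [u]
  have htay := norm_sub_taylor_le hr0 hrR hR hd hbd (N + 1)
  have hsum : ∑ j ∈ Finset.range (N + 1),
      (j.factorial : ℂ)⁻¹ • (r : ℂ) ^ j • iteratedDeriv j (G ∘ u) 0
      = formSum N (fun j => ((r : ℂ) ^ j) • q j) x := by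
    refine Finset.sum_congr rfl fun j _ => ?_
    rw [smul_comm, hcoef, _root_.smul_apply]
  rw [hsum] at htay
  have hrball : (r : ℂ) ∈ ball (0 : ℂ) 1 := by simpa [abs_of_pos hr0] using hr2
  have hrx := ball_subset_closedBall (hmem r hrball)
  have hclose : ‖(g : closedBall (0 : X) 1 →ᵇ W) x - (G ∘ u) r‖ < ε / 2 := by
    rw [Function.comp_apply, hGval _ hrx, ← dist_eq_norm]
    refine hu ?_
    rw [Subtype.dist_eq, dist_eq_norm]
    have e : (x : X) - u r = ((1 - r : ℝ) : ℂ) • (x : X) := by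
      rw [ContinuousLinearMap.toSpanSingleton_apply, Complex.ofReal_sub, sub_smul,
        Complex.ofReal_one, one_smul]
    change ‖(x : X) - u r‖ < δ
    rw [e, norm_smul, Complex.norm_real, Real.norm_of_nonneg (by linarith)]
    refine (mul_le_of_le_one_right (by linarith) hx).trans_lt ?_
    linarith
  calc ‖(g : closedBall (0 : X) 1 →ᵇ W) x - formSum N (fun j => ((r : ℂ) ^ j) • q j) x‖
      ≤ ‖(g : closedBall (0 : X) 1 →ᵇ W) x - (G ∘ u) r‖
        + ‖(G ∘ u) r - formSum N (fun j => ((r : ℂ) ^ j) • q j) x‖ :=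
        norm_sub_le_norm_sub_add_norm_sub _ _ _
    _ < ε := by linarith

end Approximation

end
theorem mainTheorem2 {X Y : Type*} [NormedAddCommGroup X] [NormedSpace ℂ X] [CompleteSpace X]
    [NormedAddCommGroup Y] [NormedSpace ℂ Y] [CompleteSpace Y]
    (hsep : TopologicalSpace.SeparableSpace (StrongDual ℂ X))
    (hAP : HasApproximationProperty (StrongDual ℂ X)) :
    Dense {f : Au X (StrongDual ℂ Y) | AronBernerAttainsNorm f} ∧
      ∀ (g : Au X (StrongDual ℂ Y)) (ε : ℝ), 0 < ε →
        ∃ P : Au X (StrongDual ℂ Y),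
          IsPolynomial P ∧ AronBernerAttainsNorm P ∧ ‖g - P‖ < ε := by
  have hX : TopologicalSpace.SeparableSpace X := separableSpace_of_separableSpace_dual
  have key : ∀ (g : Au X (StrongDual ℂ Y)) (ε : ℝ), 0 < ε → ∃ P : Au X (StrongDual ℂ Y),
      IsPolynomial P ∧ AronBernerAttainsNorm P ∧ ‖g - P‖ < ε := by
    intro g ε hε
    obtain ⟨N, Φ, hΦ⟩ := exists_formSum_near g (ε := ε / 4) (by positivity)
    -- a vanishing top coefficient is added, so that the degree of homogeneity is positive
    obtain ⟨Ψ, hΨ⟩ := exists_formSum_eq_affineDiag (N + 1) fun j => if j ≤ N then Φ j else 0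
    have hΨΦ : ∀ x, affineDiag Ψ x = formSum N Φ x := by
      intro x
      rw [← hΨ, formSum, Finset.sum_range_succ, if_neg (by omega), _root_.zero_apply, add_zero]
      refine Finset.sum_congr rfl fun j hj => ?_
      rw [if_pos (by rw [Finset.mem_range] at hj; omega)]
    obtain ⟨P, hP, hPa, hPd⟩ := exists_aronBernerAttainsNorm_near N Ψ (δ := ε / 4) (by positivity)
    refine ⟨P, hP, hPa, lt_of_le_of_lt (?_ : _ ≤ ε / 2) (by linarith)⟩
    refine (BoundedContinuousFunction.norm_le (by positivity)).2 fun x => ?_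
    have h1 := hPd x
    rw [hΨΦ, norm_sub_rev] at h1
    have h2 := norm_sub_le_norm_sub_add_norm_sub ((g : closedBall (0 : X) 1 →ᵇ StrongDual ℂ Y) x)
      (formSum N Φ x) ((P : closedBall (0 : X) 1 →ᵇ StrongDual ℂ Y) x)
    have h3 := hΦ x
    change ‖(g : closedBall (0 : X) 1 →ᵇ StrongDual ℂ Y) x
      - (P : closedBall (0 : X) 1 →ᵇ StrongDual ℂ Y) x‖ ≤ _
    linarith
  refine ⟨Metric.dense_iff.2 fun g ε hε => ?_, key⟩
  obtain ⟨P, -, hP, hd⟩ := key g ε hε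
  exact ⟨P, by rwa [mem_ball_iff_norm'], hP⟩
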